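/- Let $\mathrm{Sol}_3$ be $\mathbb R^3$ with the Riemannian metric $\langle\,,\rangle=e^{2z}dx^2+e^{-2z}dy^2+dz^2$, with Levi-Civita connection $\bar\nabla$, and let $E_3=\partial/\partial z$. Let $\phi:\Sigma^2\to\mathrm{Sol}_3$ be a smooth immersed surface (without boundary), endowed with the induced metric, and let $\xi$ be a smooth unit normal vector field along $\phi$. Let $A$ be the shape operator, $AX=-\bar\nabla_X\xi$, let $f=\tfrac12\operatorname{trace}A$ be the mean curvature function, let $K$ be the Gaussian curvature of the induced metric, and let $\nabla$, $\operatorname{div}$ and $\Delta=\operatorname{div}\operatorname{grad}$ be the Levi-Civita connection, the divergence and the Laplacian of the induced metric. The norms $|A|$ and $|\nabla A|$ are those of the induced metric on tensors, and $E_3^{\top}$, $E_3^{\perp}$ are the tangent and normal parts of $E_3$ along the surface. If the surface has constant mean curvature, i.e. $f$ is constant, then at every point of $\Sigma^2$ $$ \begin{aligned} \tfrac12\Delta|A|^2={}&|\nabla A|^2+4\operatorname{div}\big(\langle\xi,E_3^{\perp}\rangle AE_3^{\top}\big)-4\operatorname{div}\big(f\langle\xi,E_3^{\perp}\rangle E_3^{\top}\big)\\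 &+2K\big(|A|^2-2f^2\big)-8\langle\xi,E_3^{\perp}\rangle^2\big(1-\langle\xi,E_3^{\perp}\rangle^2\big). \end{aligned} $$ -/

import Mathlib

open scoped Manifold ContDiff

noncomputable section

namespace SolGeometry

/-! ### Riemannian geometry of a metric on a coordinate domain of `ℝⁿ` -/

/-- Coordinate space `ℝⁿ`; only its smooth structure is used below, not its Euclidean metric. -/
abbrev Coord (n : ℕ) : Type := EuclideanSpace ℝ (Fin n)

/-- The `i`-th standard basis vector of `ℝⁿ`. -/
def stdVec {n : ℕ} (i : Fin n) : Coord n := EuclideanSpace.single i 1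

/-- Partial derivative `∂ᵢ h` at `u`. -/
def pderiv {n : ℕ} (i : Fin n) (h : Coord n → ℝ) (u : Coord n) : ℝ :=
  fderiv ℝ h u (stdVec i)

/-- Christoffel symbols `Γᵏᵢⱼ = ½ gᵏˡ (∂ᵢ gⱼₗ + ∂ⱼ gᵢₗ - ∂ₗ gᵢⱼ)` of the Levi-Civita connection
of the metric `g`: `∇_{∂ᵢ} ∂ⱼ = Γᵏᵢⱼ ∂ₖ`. -/
def christoffel {n : ℕ} (g : Coord n → Matrix (Fin n) (Fin n) ℝ) (k i j : Fin n)
    (u : Coord n) : ℝ :=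
  (1 / 2) * ∑ l, (g u)⁻¹ k l *
    (pderiv i (fun x => g x j l) u + pderiv j (fun x => g x i l) u
      - pderiv l (fun x => g x i j) u)

/-- Components of the curvature tensor `R(X,Y)Z = ∇_X ∇_Y Z - ∇_Y ∇_X Z - ∇_{[X,Y]} Z` of `g`:
`R(∂ᵢ, ∂ⱼ)∂ₖ = ∑ l, curvature g l i j k • ∂ₗ`. -/
def curvature {n : ℕ} (g : Coord n → Matrix (Fin n) (Fin n) ℝ) (l i j k : Fin n)
    (u : Coord n) : ℝ :=
  pderiv i (christoffel g l j k) u - pderiv j (christoffel g l i k) u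
    + ∑ m, (christoffel g l i m u * christoffel g m j k u
      - christoffel g l j m u * christoffel g m i k u)

/-- Gaussian curvature `⟨R(∂₁,∂₂)∂₂, ∂₁⟩ / det g` of a metric in two variables. -/
def coordGaussCurvature (g : Coord 2 → Matrix (Fin 2) (Fin 2) ℝ) (u : Coord 2) : ℝ :=
  (∑ l, g u l 0 * curvature g l 0 1 1 u) / (g u).det

/-- Divergence `∂ᵢ Vⁱ + Γⁱᵢₖ Vᵏ` (the trace of `∇V`) of the vector field with components `Vⁱ`. -/
def coordDiv {n : ℕ} (g : Coord n → Matrix (Fin n) (Fin n) ℝ) (V : Fin n → Coord n → ℝ)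
    (u : Coord n) : ℝ :=
  ∑ i, pderiv i (V i) u + ∑ i, ∑ k, christoffel g i i k u * V k u

/-- Components `(∇ₖ T)ⁱⱼ = ∂ₖ Tⁱⱼ + Γⁱₖₗ Tˡⱼ - Γˡₖⱼ Tⁱₗ` of the covariant derivative of the
endomorphism field with components `Tⁱⱼ` (that is, `T ∂ⱼ = Tⁱⱼ ∂ᵢ`). -/
def coordCovDeriv {n : ℕ} (g : Coord n → Matrix (Fin n) (Fin n) ℝ)
    (T : Fin n → Fin n → Coord n → ℝ) (k i j : Fin n) (u : Coord n) : ℝ :=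
  pderiv k (T i j) u + ∑ l, christoffel g i k l u * T l j u
    - ∑ l, christoffel g l k j u * T i l u

/-- Squared norm `gᵏᵐ gₐᵦ gʲˡ (∇ₖT)ᵃⱼ (∇ₘT)ᵇₗ` of the covariant derivative of the
endomorphism field `T`. -/
def coordNormSqCovDeriv {n : ℕ} (g : Coord n → Matrix (Fin n) (Fin n) ℝ)
    (T : Fin n → Fin n → Coord n → ℝ) (u : Coord n) : ℝ :=
  ∑ k, ∑ m, ∑ a, ∑ b, ∑ j, ∑ l, (g u)⁻¹ k m * g u a b * (g u)⁻¹ j l *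
    coordCovDeriv g T k a j u * coordCovDeriv g T m b l u

/-! ### The Riemannian manifold `Sol₃` -/

/-- The metric `e^{2z} dx² + e^{-2z} dy² + dz²` on `ℝ³`. -/
def solMetric (x : Coord 3) : Matrix (Fin 3) (Fin 3) ℝ :=
  Matrix.diagonal ![Real.exp (2 * x 2), Real.exp (-2 * x 2), 1]

/-- The inner product of `Sol₃` at `x`, for tangent vectors given by their components in the
coordinate frame `∂/∂x, ∂/∂y, ∂/∂z`. -/
def solInner (x v w : Coord 3) : ℝ := ∑ i, ∑ j, solMetric x i j * v i * w j

/-- The vector field `E₃ = ∂/∂z`. -/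
def E₃ (_x : Coord 3) : Coord 3 := stdVec 2

/-! ### Surfaces in `Sol₃` -/

variable {M : Type*} [TopologicalSpace M] [ChartedSpace (EuclideanSpace ℝ (Fin 2)) M]

/-- The differential `dφₚ v`. It is also used for a vector field `W : M → ℝ³` along a map,
where it gives the componentwise derivative of `W` in the direction `v`. -/
def push (φ : M → Coord 3) (p : M) (v : TangentSpace (𝓡 2) p) : Coord 3 :=
  mfderiv (𝓡 2) (𝓡 3) φ p v

/-- `φ : M → Sol₃` is a smooth immersion. -/
structure IsSurface (φ : M → Coord 3) : Prop where
  smooth : ContMDiff (𝓡 2) (𝓡 3) ∞ φ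
  injective : ∀ p : M, Function.Injective (push φ p)

/-- `ξ` is a smooth unit normal vector field along `φ`. -/
structure IsUnitNormal (φ ξ : M → Coord 3) : Prop where
  smooth : ContMDiff (𝓡 2) (𝓡 3) ∞ ξ
  unit : ∀ p : M, solInner (φ p) (ξ p) (ξ p) = 1
  normal : ∀ (p : M) (v : TangentSpace (𝓡 2) p), solInner (φ p) (push φ p v) (ξ p) = 0

/-- The induced metric on the tangent plane at `p`. -/
def inducedMetric (φ : M → Coord 3) (p : M) (v w : TangentSpace (𝓡 2) p) : ℝ :=
  solInner (φ p) (push φ p v) (push φ p w)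

/-- The standard basis of the tangent space `T_p M`, which Mathlib models on `ℝ²`. -/
def tangentBasis (p : M) (i : Fin 2) : TangentSpace (𝓡 2) p := (stdVec i : Coord 2)

/-- Gram matrix of the induced metric in `tangentBasis`. -/
def gram (φ : M → Coord 3) (p : M) : Matrix (Fin 2) (Fin 2) ℝ :=
  Matrix.of fun i j => inducedMetric φ p (tangentBasis p i) (tangentBasis p j)

/-- The tangent part `w^⊤` of an ambient vector `w` at `φ p`, as an element of `T_p M`:
the vector `t` with `⟨dφ t, dφ v⟩ = ⟨w, dφ v⟩` for all `v`. -/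
def tangentPart (φ : M → Coord 3) (p : M) (w : Coord 3) : TangentSpace (𝓡 2) p :=
  ∑ i, (∑ j, (gram φ p)⁻¹ i j * solInner (φ p) w (push φ p (tangentBasis p j))) •
    tangentBasis p i

/-- The normal part `w^⊥ = ⟨w, ξ⟩ ξ` of an ambient vector `w` at `φ p`. -/
def normalPart (φ ξ : M → Coord 3) (p : M) (w : Coord 3) : Coord 3 :=
  solInner (φ p) w (ξ p) • ξ p

/-- The covariant derivative `∇̄_v W` of a vector field `W` along `φ`, with respect to the
Levi-Civita connection of `Sol₃`. -/
def ambientCovDeriv (φ W : M → Coord 3) (p : M) (v : TangentSpace (𝓡 2) p) : Coord 3 :=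
  WithLp.toLp 2 fun k =>
    push W p v k + ∑ i, ∑ j, christoffel solMetric k i j (φ p) * push φ p v i * W p j

/-- The shape operator `A v = -∇̄_v ξ` of the surface. -/
def shapeOp (φ ξ : M → Coord 3) (p : M) (v : TangentSpace (𝓡 2) p) : TangentSpace (𝓡 2) p :=
  tangentPart φ p (-ambientCovDeriv φ ξ p v)

/-- Squared norm `gⁱᵏ ⟨T eᵢ, T eₖ⟩` of an endomorphism of the tangent plane at `p`. -/
def normSq (φ : M → Coord 3) (p : M) (T : TangentSpace (𝓡 2) p → TangentSpace (𝓡 2) p) : ℝ :=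
  ∑ i, ∑ k, (gram φ p)⁻¹ i k * inducedMetric φ p (T (tangentBasis p i)) (T (tangentBasis p k))

/-- Mean curvature `f = ½ trace A`, with `trace A = gⁱᵏ ⟨A eᵢ, eₖ⟩`. -/
def meanCurvature (φ ξ : M → Coord 3) (p : M) : ℝ :=
  (1 / 2) * ∑ i, ∑ k, (gram φ p)⁻¹ i k *
    inducedMetric φ p (shapeOp φ ξ p (tangentBasis p i)) (tangentBasis p k)

/-- Constant mean curvature. -/
def IsCMC (φ ξ : M → Coord 3) : Prop := ∃ c : ℝ, ∀ p : M, meanCurvature φ ξ p = c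

/-! #### Differential operators of the induced metric

They are evaluated at `p` through the coordinate formulas in the preferred chart at `p`. -/

/-- The chart coordinates of `q` in the chart at `p`. -/
def chartCoord (p q : M) : Coord 2 := extChartAt (𝓡 2) p q

/-- The point with coordinates `u` in the chart at `p`. -/
def chartPoint (p : M) (u : Coord 2) : M := (extChartAt (𝓡 2) p).symm u

/-- The coordinate vector field `∂ᵢ` of the chart at `p`, at the point with coordinates `u`. -/
def coordField (p : M) (i : Fin 2) (u : Coord 2) : TangentSpace (𝓡 2) (chartPoint p u) :=
  mfderiv (𝓡 2) (𝓡 2) (chartPoint p) u (stdVec i : Coord 2)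

/-- The `i`-th component, with respect to the coordinate frame of the chart at `p`, of a tangent
vector `v` at `q`. -/
def component (p q : M) (i : Fin 2) (v : TangentSpace (𝓡 2) q) : ℝ :=
  (show Coord 2 from mfderiv (𝓡 2) (𝓡 2) (chartCoord p) q v) i

/-- The induced metric in the chart at `p`. -/
def chartMetric (φ : M → Coord 3) (p : M) (u : Coord 2) : Matrix (Fin 2) (Fin 2) ℝ :=
  Matrix.of fun i j => inducedMetric φ (chartPoint p u) (coordField p i u) (coordField p j u)

/-- Gaussian curvature of the induced metric. -/
def gaussCurvature (φ : M → Coord 3) (p : M) : ℝ :=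
  coordGaussCurvature (chartMetric φ p) (chartCoord p p)

/-- Divergence of a tangent vector field on the surface. -/
def div (φ : M → Coord 3) (V : ∀ q : M, TangentSpace (𝓡 2) q) (p : M) : ℝ :=
  coordDiv (chartMetric φ p)
    (fun i u => component p (chartPoint p u) i (V (chartPoint p u))) (chartCoord p p)

/-- Gradient of a function on the surface. -/
def grad (φ : M → Coord 3) (h : M → ℝ) (p : M) : TangentSpace (𝓡 2) p :=
  ∑ i, (∑ j, (gram φ p)⁻¹ i j *
    (show ℝ from mfderiv (𝓡 2) 𝓘(ℝ, ℝ) h p (tangentBasis p j))) • tangentBasis p i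

/-- The Laplacian `Δ = div grad` of the surface. -/
def laplacian (φ : M → Coord 3) (h : M → ℝ) (p : M) : ℝ := div φ (grad φ h) p

/-- `|∇A|²`, the squared norm of the covariant derivative of the shape operator. -/
def normSqNablaShape (φ ξ : M → Coord 3) (p : M) : ℝ :=
  coordNormSqCovDeriv (chartMetric φ p)
    (fun i j u =>
      component p (chartPoint p u) i (shapeOp φ ξ (chartPoint p u) (coordField p j u)))
    (chartCoord p p)

/-- `|A|²`. -/
def normSqShape (φ ξ : M → Coord 3) (p : M) : ℝ := normSq φ p (shapeOp φ ξ p)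

/-- The function `⟨ξ, E₃^⊥⟩` on the surface. -/
def angle (φ ξ : M → Coord 3) (p : M) : ℝ :=
  solInner (φ p) (ξ p) (normalPart φ ξ p (E₃ (φ p)))

/-- The tangent vector field `E₃^⊤` on the surface. -/
def E₃Tan (φ : M → Coord 3) (p : M) : TangentSpace (𝓡 2) p := tangentPart φ p (E₃ (φ p))

end SolGeometry

end

/-! Write `S` for the shape operator, `ν = ⟨ξ, E₃⟩` (which equals `⟨ξ, E₃^⊥⟩`), `B = ν E₃^⊤`, and
`b` for the covector dual to `B`. Along the surface the only trace of the curvature of `Sol₃` that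
matters is the Codazzi equation `(∇ₖS)ⁱⱼ - (∇ⱼS)ⁱₖ = -2(δⁱⱼ bₖ - δⁱₖ bⱼ)`. Since `tr S = 2f` is
constant, contracting it gives `div S = 2b`.

The rest is Simons' argument for such a tensor. Codazzi turns `grad |S|²` into `2 Sʲᵢ ∇ⱼSⁱˡ + 4 SB -
4 (tr S) B`. In the divergence of `Sʲᵢ ∇ⱼSⁱˡ` there are two contributions. The product of two
derivatives becomes `|∇S|² - 4|B|²` by Codazzi once more. The second-order term is commuted: in
dimension two the commutator is `K(2|S|² - (tr S)²)`, and what remains is `S` contracted with `∇(div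
S) = 2∇B`, that is `2 div(SB) - 4|B|²`. Finally `|B|² = ν²(1 - ν²)`, because `E₃` is a unit field.
No Gauss equation is needed, as `K` stays intrinsic.

The index calculus is carried out over an arbitrary commutative `ℝ`-algebra with two commuting
derivations, where every identity is polynomial and no differentiability has to be checked
(`laplacian_trace_sq_of_codazzi`). The geometry of `Sol₃` enters in the left-invariant orthonormal
frame, whose connection coefficients are constant (`frameCov_comm`, `codazzi`, `simons`). Smooth
functions on a chart domain form such an algebra, and evaluation at a point gives the coordinate
identity `simons_param`. The remaining work identifies the quantities defined on the surface with
coordinate expressions in one fixed chart. -/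

noncomputable section

namespace SolGeometry

/-! ### Tensor calculus in two variables over a ring with two commuting derivations -/

section Intrinsic

variable {R : Type*} [CommRing R] [Algebra ℝ R]

/-- Covariant derivative of a tensor of type `(1,1)`. -/
def covMixed (D : Fin 2 → Derivation ℝ R R) (Γ : Fin 2 → Fin 2 → Fin 2 → R)
    (S : Fin 2 → Fin 2 → R) (k i j : Fin 2) : R :=
  D k (S i j) + ∑ l, Γ i k l * S l j - ∑ l, Γ l k j * S i l

/-- Covariant derivative of a tensor of type `(2,0)`. -/
def covContra (D : Fin 2 → Derivation ℝ R R) (Γ : Fin 2 → Fin 2 → Fin 2 → R)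
    (H : Fin 2 → Fin 2 → R) (k i j : Fin 2) : R :=
  D k (H i j) + ∑ l, Γ i k l * H l j + ∑ l, Γ j k l * H i l

/-- Divergence of a vector field. -/
def ringDiv (D : Fin 2 → Derivation ℝ R R) (Γ : Fin 2 → Fin 2 → Fin 2 → R)
    (V : Fin 2 → R) : R :=
  ∑ i, D i (V i) + ∑ i, ∑ k, Γ i i k * V k

/-- Curvature tensor of the connection with symbols `Γ`. -/
def ringCurvature (D : Fin 2 → Derivation ℝ R R) (Γ : Fin 2 → Fin 2 → Fin 2 → R)
    (l i j k : Fin 2) : R :=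
  D i (Γ l j k) - D j (Γ l i k) + ∑ m, (Γ l i m * Γ m j k - Γ l j m * Γ m i k)

/-- `Γ` is the Levi-Civita connection of the metric `g` with inverse `G`, for commuting
derivations `D`. -/
structure IsLeviCivita (D : Fin 2 → Derivation ℝ R R) (g G : Fin 2 → Fin 2 → R)
    (Γ : Fin 2 → Fin 2 → Fin 2 → R) : Prop where
  comm : ∀ i j x, D i (D j x) = D j (D i x)
  symm : ∀ i j, g i j = g j i
  symm_inv : ∀ i j, G i j = G j i
  mul_inv : ∀ i j, ∑ m, g i m * G m j = if i = j then 1 else 0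
  torsion : ∀ k i j, Γ k i j = Γ k j i
  compat : ∀ k i j, D k (g i j) = ∑ l, (g l j * Γ l k i + g i l * Γ l k j)

/-- An `ℝ`-algebra contains the inverse of 2; this replaces division in the symmetry arguments
below. -/
theorem eq_zero_of_two_mul {x : R} (h : 2 * x = 0) : x = 0 := by
  have h2 : (algebraMap ℝ R (1 / 2)) * 2 = 1 := by
    rw [← map_ofNat (algebraMap ℝ R) 2, ← map_mul]; norm_num
  linear_combination (algebraMap ℝ R (1 / 2)) * h - x * h2

namespace IsLeviCivita

variable {D : Fin 2 → Derivation ℝ R R} {g G : Fin 2 → Fin 2 → R}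
  {Γ : Fin 2 → Fin 2 → Fin 2 → R}

theorem inv_mul (h : IsLeviCivita D g G Γ) (i j : Fin 2) :
    ∑ m, G i m * g m j = if i = j then 1 else 0 := by
  have := h.mul_inv j i
  simp only [eq_comm (a := j)] at this
  rw [← this]
  exact Finset.sum_congr rfl fun m _ => by rw [h.symm_inv i m, h.symm m j, mul_comm]

/-- Differentiating `g G = 1` and using `∇g = 0` gives `g · ∇G = 0`; multiplication by `G` then
isolates `∇G`. -/
theorem covContra_inv (h : IsLeviCivita D g G Γ) (k i j : Fin 2) :
    covContra D Γ G k i j = 0 := by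
  have key : ∀ a, ∑ m, g a m * covContra D Γ G k m j = 0 := by
    intro a
    have h1 := congrArg (D k) (h.mul_inv a j)
    have h2 : D k (if a = j then (1 : R) else 0) = 0 := by split_ifs <;> simp
    have h3 := fun b => h.mul_inv b j
    rw [h2] at h1
    simp only [Fin.sum_univ_two, map_add, Derivation.leibniz, smul_eq_mul, h.compat,
      covContra] at h1 h3 ⊢
    have h4 := h.mul_inv a 0
    have h5 := h.mul_inv a 1
    simp only [Fin.sum_univ_two] at h4 h5
    have h6 : (∑ b, Γ b k a * (g b 0 * G 0 j + g b 1 * G 1 j)) = Γ j k a := by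
      simp only [h3]; simp
    have h7 : (g a 0 * G 0 0 + g a 1 * G 1 0) * Γ j k 0
        + (g a 0 * G 0 1 + g a 1 * G 1 1) * Γ j k 1 = Γ j k a := by
      rw [h4, h5]; fin_cases a <;> simp
    simp only [Fin.sum_univ_two] at h6
    linear_combination h1 - h6 + h7
  have h1 : ∑ a, G i a * ∑ m, g a m * covContra D Γ G k m j = covContra D Γ G k i j := by
    have h4 := h.inv_mul i 0
    have h5 := h.inv_mul i 1
    simp only [Fin.sum_univ_two] at h4 h5 ⊢
    have : covContra D Γ G k i j = (if i = 0 then 1 else 0) * covContra D Γ G k 0 j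
        + (if i = 1 then 1 else 0) * covContra D Γ G k 1 j := by
      fin_cases i <;> simp
    rw [this]
    linear_combination covContra D Γ G k 0 j * h4 + covContra D Γ G k 1 j * h5
  rw [← h1]; simp [key]

theorem deriv_inv (h : IsLeviCivita D g G Γ) (k i j : Fin 2) :
    D k (G i j) = -∑ l, Γ i k l * G l j - ∑ l, Γ j k l * G i l := by
  have := h.covContra_inv k i j
  unfold covContra at this
  linear_combination this

/-- Raising an index commutes with `∇` because the inverse metric is parallel. -/
theorem covContra_raise (h : IsLeviCivita D g G Γ) (S : Fin 2 → Fin 2 → R) (k i l : Fin 2) :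
    covContra D Γ (fun i l => ∑ m, G l m * S i m) k i l
      = ∑ m, G l m * covMixed D Γ S k i m := by
  simp only [covContra, covMixed, Fin.sum_univ_two, map_add, Derivation.leibniz, smul_eq_mul,
    h.deriv_inv]
  ring

theorem raise_symm (h : IsLeviCivita D g G Γ) {S : Fin 2 → Fin 2 → R}
    (hS : ∀ i j, ∑ l, g i l * S l j = ∑ l, g j l * S l i) (i l : Fin 2) :
    ∑ m, G l m * S i m = ∑ m, G i m * S l m := by
  have e : ∀ i l, ∑ m, G l m * S i m = ∑ m, ∑ a, G l m * G i a * ∑ b, g a b * S b m := by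
    intro i l
    refine Finset.sum_congr rfl fun m _ => ?_
    have h4 := h.inv_mul i 0
    have h5 := h.inv_mul i 1
    simp only [Fin.sum_univ_two] at h4 h5 ⊢
    have : S i m = (if i = 0 then 1 else 0) * S 0 m + (if i = 1 then 1 else 0) * S 1 m := by
      fin_cases i <;> simp
    rw [this]
    linear_combination -G l m * S 0 m * h4 - G l m * S 1 m * h5
  rw [e, e, Finset.sum_comm]
  refine Finset.sum_congr rfl fun m _ => Finset.sum_congr rfl fun a _ => ?_
  rw [hS, mul_comm (G l a)]

/-- Lowering an index commutes with `∇` since `g` is parallel, so differentiating the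
self-adjointness of `S` gives that of each `∇ₖS`. -/
theorem covMixed_lower_symm (h : IsLeviCivita D g G Γ) {S : Fin 2 → Fin 2 → R}
    (hS : ∀ i j, ∑ l, g i l * S l j = ∑ l, g j l * S l i) (k i j : Fin 2) :
    ∑ l, g i l * covMixed D Γ S k l j = ∑ l, g j l * covMixed D Γ S k l i := by
  have h1 := congrArg (D k) (hS i j)
  have e : ∀ i j, ∑ l, g i l * covMixed D Γ S k l j = D k (∑ l, g i l * S l j)
      - ∑ m, Γ m k i * ∑ l, g m l * S l j - ∑ m, Γ m k j * ∑ l, g i l * S l m := by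
    intro i j
    simp only [covMixed, Fin.sum_univ_two, map_add, Derivation.leibniz, smul_eq_mul, h.compat]
    ring
  rw [e, e, h1]
  have f : ∀ i j, ∑ m, Γ m k i * ∑ l, g m l * S l j = ∑ m, Γ m k i * ∑ l, g j l * S l m :=
    fun i j => Finset.sum_congr rfl fun m _ => by rw [hS m j]
  rw [f, f]
  ring

/-- In a full contraction the connection terms cancel, so `D` may be replaced by the covariant
derivative. -/
theorem deriv_trace_sq (D : Fin 2 → Derivation ℝ R R) (Γ : Fin 2 → Fin 2 → Fin 2 → R)
    (S : Fin 2 → Fin 2 → R) (k : Fin 2) :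
    D k (∑ i, ∑ j, S i j * S j i) = 2 * ∑ i, ∑ j, S j i * covMixed D Γ S k i j := by
  simp only [covMixed, Fin.sum_univ_two, map_add, Derivation.leibniz, smul_eq_mul]
  ring

theorem covMixed_trace (D : Fin 2 → Derivation ℝ R R) (Γ : Fin 2 → Fin 2 → Fin 2 → R)
    (S : Fin 2 → Fin 2 → R) (k : Fin 2) :
    ∑ i, covMixed D Γ S k i i = D k (∑ i, S i i) := by
  simp only [covMixed, Fin.sum_univ_two, map_add]
  ring

/-- The curvature with lowered first index is skew. -/
theorem lower_curvature_skew (h : IsLeviCivita D g G Γ) (l k : Fin 2) :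
    ∑ m, g l m * ringCurvature D Γ m 0 1 k + ∑ m, g k m * ringCurvature D Γ m 0 1 l = 0 := by
  -- Second derivatives of `g` commute; once they are expanded by metric compatibility, the only
  -- terms left are the two lowered curvatures.
  have h1 := h.comm 0 1 (g l k)
  simp only [h.compat, Fin.sum_univ_two, map_add, Derivation.leibniz, smul_eq_mul] at h1
  simp only [ringCurvature, Fin.sum_univ_two]
  simp only [h.symm k 0, h.symm k 1, h.symm 1 0] at h1 ⊢
  linear_combination h1

/-- In two variables the curvature tensor is determined by the Gaussian curvature `κ`. -/
theorem curvature_eq (h : IsLeviCivita D g G Γ) {κ : R}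
    (hκ : ∑ l, g l 0 * ringCurvature D Γ l 0 1 1 = κ * (g 0 0 * g 1 1 - g 0 1 * g 1 0))
    (m k : Fin 2) :
    ringCurvature D Γ m 0 1 k
      = κ * ((if m = 0 then g 1 k else 0) - (if m = 1 then g 0 k else 0)) := by
  set Δ := g 0 0 * g 1 1 - g 0 1 * g 1 0 with hΔ
  -- Skew-symmetry kills the diagonal components and leaves a single independent one, which `hκ`
  -- prescribes. The index is raised again afterwards.
  have low : ∀ l k, ∑ m, g l m * ringCurvature D Γ m 0 1 k
      = κ * (g l 0 * g 1 k - g l 1 * g 0 k) := by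
    have h01 : ∑ m, g 0 m * ringCurvature D Γ m 0 1 1 = κ * Δ := by
      rw [← hκ]; exact Finset.sum_congr rfl fun m _ => by rw [h.symm]
    have h10 := h.lower_curvature_skew 0 1
    have h00 := eq_zero_of_two_mul ((two_mul _).trans (h.lower_curvature_skew 0 0))
    have h11 := eq_zero_of_two_mul ((two_mul _).trans (h.lower_curvature_skew 1 1))
    intro l k
    fin_cases l <;> fin_cases k <;> simp only [Fin.zero_eta, Fin.mk_one]
    · rw [h00, h.symm 1 0]; ring
    · rw [h01, hΔ, h.symm 1 0]
    · rw [eq_neg_of_add_eq_zero_right h10, h01, hΔ, h.symm 1 0]; ring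
    · rw [h11, h.symm 1 0]; ring
  have e0 := h.inv_mul m 0
  have e1 := h.inv_mul m 1
  have l0 := low 0 k
  have l1 := low 1 k
  simp only [Fin.sum_univ_two] at e0 e1 l0 l1
  have e2 : ringCurvature D Γ m 0 1 k = (if m = 0 then 1 else 0) * ringCurvature D Γ 0 0 1 k
      + (if m = 1 then 1 else 0) * ringCurvature D Γ 1 0 1 k := by
    fin_cases m <;> simp
  have e3 : (if m = 0 then g 1 k else 0) - (if m = 1 then g 0 k else 0)
      = (if m = 0 then 1 else 0) * g 1 k - (if m = 1 then 1 else 0) * g 0 k := by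
    fin_cases m <;> simp
  rw [e2, e3]
  linear_combination G m 0 * l0 + G m 1 * l1 - e0 * ringCurvature D Γ 0 0 1 k
    - e1 * ringCurvature D Γ 1 0 1 k + κ * g 1 k * e0 - κ * g 0 k * e1

/-- Divergence of the vector field `Sʲᵢ ∇ⱼ Hⁱˡ`, after commuting covariant derivatives. -/
theorem div_contract (h : IsLeviCivita D g G Γ) {κ : R}
    (hκ : ∑ l, g l 0 * ringCurvature D Γ l 0 1 1 = κ * (g 0 0 * g 1 1 - g 0 1 * g 1 0))
    (S H : Fin 2 → Fin 2 → R) (hH : ∀ i j, H i j = H j i) :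
    ringDiv D Γ (fun l => ∑ j, ∑ i, S j i * covContra D Γ H j i l)
      = ∑ l, ∑ j, ∑ i, covMixed D Γ S l j i * covContra D Γ H j i l
        + ∑ j, ∑ i, S j i * (D j (∑ l, covContra D Γ H l i l)
          + ∑ m, Γ i j m * ∑ l, covContra D Γ H l m l)
        + κ * (2 * ∑ i, ∑ j, ∑ m, S j i * g j m * H i m
          - (∑ i, S i i) * ∑ l, ∑ m, g l m * H l m) := by
  have c := h.curvature_eq hκ
  have c00 := c 0 0
  have c01 := c 0 1
  have c10 := c 1 0
  have c11 := c 1 1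
  simp only [ringCurvature, Fin.sum_univ_two, h.torsion _ 1 0, h.symm 1 0, if_true,
    zero_ne_one, one_ne_zero, if_false] at c00 c01 c10 c11
  simp only [ringDiv, covMixed, covContra, Fin.sum_univ_two, map_add,
    Derivation.leibniz, smul_eq_mul, h.comm 1 0, hH 1 0, h.torsion _ 1 0, h.symm 1 0]
  -- Commuting `∇ₗ∇ⱼ` on `Hⁱˡ` produces one curvature term per upper index. The coefficients collect
  -- these terms, contracted with `S`, for each component `Rᵐ₀₁ₖ`.
  linear_combination (S 1 0 * H 0 0 + S 1 0 * H 0 0 + S 1 1 * H 0 1 - S 0 0 * H 0 1) * c00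
    + (S 1 0 * H 0 1 + S 1 0 * H 0 1 + S 1 1 * H 1 1 - S 0 0 * H 1 1) * c01
    + (S 1 1 * H 0 0 - S 0 1 * H 0 1 - S 0 0 * H 0 0 - S 0 1 * H 0 1) * c10
    + (S 1 1 * H 0 1 - S 0 1 * H 1 1 - S 0 0 * H 0 1 - S 0 1 * H 1 1) * c11

theorem sum_inv_mul_lower (h : IsLeviCivita D g G Γ) (B : Fin 2 → R) (i : Fin 2) :
    ∑ k, G i k * ∑ l, g k l * B l = B i := by
  have e0 := h.inv_mul i 0
  have e1 := h.inv_mul i 1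
  simp only [Fin.sum_univ_two] at e0 e1 ⊢
  have : B i = (if i = 0 then 1 else 0) * B 0 + (if i = 1 then 1 else 0) * B 1 := by
    fin_cases i <;> simp
  rw [this]
  linear_combination B 0 * e0 + B 1 * e1

theorem sum_lower_mul_inv (h : IsLeviCivita D g G Γ) (B : Fin 2 → R) (i : Fin 2) :
    ∑ k, g i k * ∑ l, G k l * B l = B i := by
  have e0 := h.mul_inv i 0
  have e1 := h.mul_inv i 1
  simp only [Fin.sum_univ_two] at e0 e1 ⊢
  have : B i = (if i = 0 then 1 else 0) * B 0 + (if i = 1 then 1 else 0) * B 1 := by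
    fin_cases i <;> simp
  rw [this]
  linear_combination B 0 * e0 + B 1 * e1

/-! ### Simons' formula for tensors satisfying a Codazzi equation -/

variable {S : Fin 2 → Fin 2 → R} {b B : Fin 2 → R}

/-- Trace of the Codazzi equation: the divergence of `S`. -/
theorem div_eq_of_codazzi
    (htr : ∀ k, D k (∑ i, S i i) = 0)
    (hcod : ∀ k i j, covMixed D Γ S k i j - covMixed D Γ S j i k
      = -2 * ((if i = j then b k else 0) - (if i = k then b j else 0))) (k : Fin 2) :
    ∑ i, covMixed D Γ S i i k = 2 * b k := by
  have h1 := covMixed_trace D Γ S k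
  have h2 : ∑ i, (covMixed D Γ S k i i - covMixed D Γ S i i k) = -2 * b k := by
    simp only [hcod]
    rw [← Finset.mul_sum]
    fin_cases k <;> simp <;> ring
  rw [Finset.sum_sub_distrib, h1, htr] at h2
  linear_combination -h2

/-- Codazzi exchanges the derivative index with an index of `S`. The main term then has the form
treated by `div_contract`, where commuting derivatives brings out `div S`. Self-adjointness
identifies `S` acting on the covector `b` with `S` acting on the vector `B`. -/
theorem grad_trace_sq_of_codazzi (h : IsLeviCivita D g G Γ)
    (hS : ∀ i j, ∑ l, g i l * S l j = ∑ l, g j l * S l i)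
    (hb : ∀ k, b k = ∑ l, g k l * B l)
    (hcod : ∀ k i j, covMixed D Γ S k i j - covMixed D Γ S j i k
      = -2 * ((if i = j then b k else 0) - (if i = k then b j else 0))) (l : Fin 2) :
    ∑ k, G l k * D k (∑ i, ∑ j, S i j * S j i)
      = 2 * (∑ j, ∑ i, S j i * covContra D Γ (fun i l => ∑ m, G l m * S i m) j i l)
        + 4 * ∑ m, S l m * B m - 4 * ((∑ i, S i i) * B l) := by
  have hD : ∀ k, D k (∑ i, ∑ j, S i j * S j i) = 2 * (∑ j, ∑ i, S j i * covMixed D Γ S j i k)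
      - 4 * (∑ i, S i i) * b k + 4 * ∑ j, S j k * b j := by
    intro k
    have e : ∀ i j, covMixed D Γ S k i j = covMixed D Γ S j i k
        + -2 * ((if i = j then b k else 0) - (if i = k then b j else 0)) := fun i j => by
      rw [← hcod]; ring
    rw [deriv_trace_sq D Γ S k]
    simp only [e]
    fin_cases k <;> simp [Fin.sum_univ_two] <;> ring
  have hB : ∑ k, G l k * b k = B l := by
    simp only [hb]; exact h.sum_inv_mul_lower B l
  have hSB : ∑ k, G l k * ∑ j, S j k * b j = ∑ m, S l m * B m := by
    have e1 : ∑ k, G l k * ∑ j, S j k * b j = ∑ j, (∑ k, G l k * S j k) * b j := by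
      simp only [Fin.sum_univ_two]; ring
    have e2 : ∑ j, (∑ k, G l k * S j k) * b j = ∑ j, (∑ k, G j k * S l k) * b j :=
      Finset.sum_congr rfl fun j _ => by rw [h.raise_symm hS]
    have e3 : ∑ m, S l m * B m = ∑ m, S l m * ∑ k, G m k * b k := by
      simp only [hb, h.sum_inv_mul_lower B]
    rw [e1, e2, e3]
    simp only [Fin.sum_univ_two, h.symm_inv 1 0]
    ring
  simp only [h.covContra_raise, hD]
  rw [← hB, ← hSB]
  simp only [Fin.sum_univ_two]
  ring

/-- As each `∇ₖS` is self-adjoint, its norm is a trace of a product, in which `g` no longer appears;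
this is the form that Codazzi produces. -/
theorem norm_sq_covMixed (h : IsLeviCivita D g G Γ)
    (hS : ∀ i j, ∑ l, g i l * S l j = ∑ l, g j l * S l i) :
    ∑ k, ∑ m, ∑ a, ∑ b, ∑ j, ∑ l, G k m * g a b * G j l *
        covMixed D Γ S k a j * covMixed D Γ S m b l
      = ∑ l, ∑ m, ∑ j, ∑ i, G l m * covMixed D Γ S l j i * covMixed D Γ S m i j := by
  refine Finset.sum_congr rfl fun k _ => Finset.sum_congr rfl fun m _ => ?_
  have e1 : ∀ b j, ∑ a, g a b * covMixed D Γ S k a j = ∑ a, g j a * covMixed D Γ S k a b := by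
    intro b j
    rw [← h.covMixed_lower_symm hS]
    exact Finset.sum_congr rfl fun a _ => by rw [h.symm]
  have e2 : ∀ b l, ∑ j, G j l * ∑ a, g j a * covMixed D Γ S k a b = covMixed D Γ S k l b := by
    intro b l
    simp only [h.symm_inv _ l]
    exact h.sum_inv_mul_lower (fun a => covMixed D Γ S k a b) l
  have e3 : ∑ a, ∑ b, ∑ j, ∑ l, G k m * g a b * G j l *
        covMixed D Γ S k a j * covMixed D Γ S m b l
      = ∑ b, ∑ l, G k m * (∑ j, G j l * ∑ a, g a b * covMixed D Γ S k a j)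
        * covMixed D Γ S m b l := by
    simp only [Fin.sum_univ_two]; ring
  rw [e3, Finset.sum_comm]
  simp only [e1, e2]

theorem ringDiv_linear_combination (Γ : Fin 2 → Fin 2 → Fin 2 → R) {t : R}
    (ht : ∀ k, D k t = 0) (X Y Z : Fin 2 → R) :
    ringDiv D Γ (fun l => 2 * X l + 4 * Y l - 4 * (t * Z l))
      = 2 * ringDiv D Γ X + 4 * ringDiv D Γ Y - 4 * (t * ringDiv D Γ Z) := by
  have h2 : ∀ j x, D j (2 * x) = 2 * D j x := fun j x => by rw [two_mul, map_add, two_mul]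
  have h4 : ∀ j x, D j (4 * x) = 4 * D j x := fun j x => by
    rw [show (4 : R) = 2 * 2 by norm_num, mul_assoc, h2, h2, mul_assoc]
  simp only [ringDiv, Fin.sum_univ_two, map_sub, map_add, h2, h4, Derivation.leibniz, ht,
    smul_eq_mul]
  ring

/-- Simons' formula for a symmetric tensor with constant trace that satisfies a Codazzi equation
with the right-hand side prescribed by a vector field `B`. -/
theorem laplacian_trace_sq_of_codazzi (h : IsLeviCivita D g G Γ) {κ : R}
    (hκ : ∑ l, g l 0 * ringCurvature D Γ l 0 1 1 = κ * (g 0 0 * g 1 1 - g 0 1 * g 1 0))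
    (hS : ∀ i j, ∑ l, g i l * S l j = ∑ l, g j l * S l i)
    (htr : ∀ k, D k (∑ i, S i i) = 0)
    (hb : ∀ k, b k = ∑ l, g k l * B l)
    (hcod : ∀ k i j, covMixed D Γ S k i j - covMixed D Γ S j i k
      = -2 * ((if i = j then b k else 0) - (if i = k then b j else 0))) :
    ringDiv D Γ (fun l => ∑ k, G l k * D k (∑ i, ∑ j, S i j * S j i))
      = 2 * (∑ k, ∑ m, ∑ a, ∑ b, ∑ j, ∑ l, G k m * g a b * G j l *
          covMixed D Γ S k a j * covMixed D Γ S m b l)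
        + 8 * ringDiv D Γ (fun l => ∑ m, S l m * B m)
        - 4 * ((∑ i, S i i) * ringDiv D Γ B)
        + 2 * κ * (2 * (∑ i, ∑ j, S i j * S j i) - (∑ i, S i i) * (∑ i, S i i))
        - 16 * ∑ k, b k * B k := by
  set H : Fin 2 → Fin 2 → R := fun i l => ∑ m, G l m * S i m with hH
  have hHs : ∀ i l, H i l = H l i := fun i l => h.raise_symm hS i l
  have hdiv := div_eq_of_codazzi htr hcod
  have hGb : ∀ i, ∑ m, G i m * b m = B i := fun i => by
    simp only [hb]; exact h.sum_inv_mul_lower B i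
  have hdivH : ∀ i, ∑ l, covContra D Γ H l i l = 2 * B i := by
    intro i
    -- By symmetry of `H` either slot may be contracted; the contraction in the first one is the
    -- raised `div S = 2b`.
    have e1 : ∑ l, covContra D Γ H l i l = ∑ l, covContra D Γ H l l i := by
      refine Finset.sum_congr rfl fun l _ => ?_
      simp only [covContra, hHs i l]
      simp only [hHs _ l, hHs i]
      ring
    rw [e1]
    simp only [hH, h.covContra_raise]
    rw [Finset.sum_comm]
    simp only [← Finset.mul_sum, hdiv]
    rw [← hGb, Finset.mul_sum]
    exact Finset.sum_congr rfl fun m _ => by ring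
  have hlow : ∀ i j, ∑ m, g j m * H i m = S i j := fun i j =>
    h.sum_lower_mul_inv (fun m => S i m) j
  rw [h.norm_sq_covMixed hS]
  -- A second use of Codazzi. Of the two Kronecker corrections, one meets the divergence `2B` (`q1`)
  -- and contributes `-4|B|²`; the other meets the trace of `∇S`, which vanishes (`q2`).
  have hQ : ∑ l, ∑ j, ∑ i, covMixed D Γ S l j i * covContra D Γ H j i l
      = ∑ l, ∑ m, ∑ j, ∑ i, G l m * covMixed D Γ S l j i * covMixed D Γ S m i j
        - 4 * ∑ k, b k * B k := by
    have e : ∀ i j m, covMixed D Γ S j i m = covMixed D Γ S m i j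
        + -2 * ((if i = m then b j else 0) - (if i = j then b m else 0)) := fun i j m => by
      rw [← hcod]; ring
    have q1 : ∀ j, ∑ l, ∑ m, G l m * covMixed D Γ S l j m = 2 * B j := by
      intro j
      rw [← hdivH]
      simp only [hH, h.covContra_raise]
    have q2 : ∀ l, ∑ i, covMixed D Γ S l i i = 0 := fun l => by
      rw [covMixed_trace, htr]
    have q3 : ∑ l, ∑ j, ∑ i, covMixed D Γ S l j i * covContra D Γ H j i l
        = ∑ l, ∑ m, ∑ j, ∑ i, G l m * covMixed D Γ S l j i * covMixed D Γ S m i j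
          - 2 * ∑ j, (∑ l, ∑ m, G l m * covMixed D Γ S l j m) * b j
          + 2 * ∑ l, ∑ m, G l m * b m * ∑ i, covMixed D Γ S l i i := by
      have q4 : ∀ l j i, covMixed D Γ S l j i * covContra D Γ H j i l
          = ∑ m, (G l m * covMixed D Γ S l j i * covMixed D Γ S m i j
            - 2 * (G l m * covMixed D Γ S l j i *
              ((if i = m then b j else 0) - (if i = j then b m else 0)))) := by
        intro l j i
        rw [hH, h.covContra_raise, Finset.mul_sum]
        refine Finset.sum_congr rfl fun m _ => ?_
        rw [e i j m]
        ring
      simp only [q4]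
      simp only [Fin.sum_univ_two, if_true, zero_ne_one, one_ne_zero, if_false]
      ring
    rw [q3]
    simp only [q1, q2]
    simp only [Fin.sum_univ_two]
    ring
  -- Leibniz rule `div(SB) = S · ∇B + (div S)(B)`, with `div S = 2b`.
  have hSdB : ∑ j, ∑ i, S j i * (D j (2 * B i) + ∑ m, Γ i j m * (2 * B m))
      = 2 * ringDiv D Γ (fun l => ∑ m, S l m * B m) - 4 * ∑ k, b k * B k := by
    have h2 : ∀ j x, D j (2 * x) = 2 * D j x := fun j x => by rw [two_mul, map_add, two_mul]
    have e : ringDiv D Γ (fun l => ∑ m, S l m * B m)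
        = ∑ j, ∑ i, S j i * (D j (B i) + ∑ m, Γ i j m * B m)
          + ∑ i, (∑ j, covMixed D Γ S j j i) * B i := by
      simp only [ringDiv, covMixed, Fin.sum_univ_two, map_add, Derivation.leibniz, smul_eq_mul]
      ring
    rw [e]
    simp only [hdiv, h2]
    simp only [Fin.sum_univ_two]
    ring
  have hK : κ * (2 * ∑ i, ∑ j, ∑ m, S j i * g j m * H i m
          - (∑ i, S i i) * ∑ l, ∑ m, g l m * H l m)
      = κ * (2 * (∑ i, ∑ j, S i j * S j i) - (∑ i, S i i) * (∑ i, S i i)) := by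
    simp only [hlow, mul_assoc, ← Finset.mul_sum]
    congr 4
    exact funext fun i => Finset.sum_congr rfl fun j _ => mul_comm _ _
  have main := h.div_contract hκ S H hHs
  simp only [hdivH, hQ, hSdB, hK] at main
  have hlin : ringDiv D Γ (fun l => ∑ k, G l k * D k (∑ i, ∑ j, S i j * S j i))
      = 2 * ringDiv D Γ (fun l => ∑ j, ∑ i, S j i * covContra D Γ H j i l)
        + 4 * ringDiv D Γ (fun l => ∑ m, S l m * B m) - 4 * ((∑ i, S i i) * ringDiv D Γ B) := by
    simp only [h.grad_trace_sq_of_codazzi hS hb hcod]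
    exact ringDiv_linear_combination Γ htr _ _ _
  rw [hlin, main]
  ring

end IsLeviCivita

end Intrinsic

/-! ### Surfaces in `Sol₃` in the left-invariant orthonormal frame -/

section Frame

variable {R : Type*} [CommRing R] [Algebra ℝ R]

/-- Covariant derivative in `Sol₃`, in the direction `e k`, of a field along a surface with
components `W` in the orthonormal frame `e^{-z} ∂/∂x, e^z ∂/∂y, ∂/∂z`. -/
def frameCov (D : Fin 2 → Derivation ℝ R R) (e : Fin 2 → Fin 3 → R) (W : Fin 3 → R)
    (k : Fin 2) : Fin 3 → R :=
  ![D k (W 0) + e k 0 * W 2, D k (W 1) - e k 1 * W 2, D k (W 2) - e k 0 * W 0 + e k 1 * W 1]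

/-- The coordinate fields `e` and the unit normal `n` of a surface in `Sol₃`, in components with
respect to the orthonormal frame. -/
structure IsSolFrame (D : Fin 2 → Derivation ℝ R R) (e : Fin 2 → Fin 3 → R)
    (n : Fin 3 → R) : Prop where
  torsion : ∀ k j, frameCov D e (e j) k = frameCov D e (e k) j
  unit : ∑ α, n α * n α = 1
  normal : ∀ j, ∑ α, e j α * n α = 0

/-- First fundamental form. -/
def frameMetric (e : Fin 2 → Fin 3 → R) (i j : Fin 2) : R := ∑ α, e i α * e j α

/-- Second fundamental form. -/
def frameSecond (D : Fin 2 → Derivation ℝ R R) (e : Fin 2 → Fin 3 → R) (n : Fin 3 → R)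
    (i j : Fin 2) : R :=
  -∑ α, frameCov D e n i α * e j α

/-- Shape operator. -/
def frameShape (D : Fin 2 → Derivation ℝ R R) (G : Fin 2 → Fin 2 → R) (e : Fin 2 → Fin 3 → R)
    (n : Fin 3 → R) (i j : Fin 2) : R :=
  ∑ k, G i k * frameSecond D e n j k

/-- The connection coefficients are skew in the orthonormal frame, so their contributions to the two
sums cancel. -/
theorem frameCov_compat (D : Fin 2 → Derivation ℝ R R) (e : Fin 2 → Fin 3 → R)
    (V W : Fin 3 → R) (k : Fin 2) :
    D k (∑ α, V α * W α) = ∑ α, frameCov D e V k α * W α + ∑ α, V α * frameCov D e W k α := by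
  simp only [Fin.sum_univ_three, frameCov, map_add, Derivation.leibniz, smul_eq_mul,
    Matrix.cons_val_zero, Matrix.cons_val_one, Matrix.cons_val]
  ring

namespace IsSolFrame

variable {D : Fin 2 → Derivation ℝ R R} {e : Fin 2 → Fin 3 → R} {n : Fin 3 → R}
  {G : Fin 2 → Fin 2 → R} {Γ : Fin 2 → Fin 2 → Fin 2 → R}

/-- The Ricci identity in `Sol₃`. -/
theorem frameCov_comm (h : IsSolFrame D e n) (hc : ∀ i j x, D i (D j x) = D j (D i x))
    (W : Fin 3 → R) (k j : Fin 2) (α : Fin 3) :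
    frameCov D e (frameCov D e W j) k α - frameCov D e (frameCov D e W k) j α
      = (∑ β, e j β * W β) * e k α - (∑ β, e k β * W β) * e j α
        - 2 * (e j 2 * W 2 * e k α - e k 2 * W 2 * e j α
          + if α = 2 then (∑ β, e j β * W β) * e k 2 - (∑ β, e k β * W β) * e j 2 else 0) := by
  have t := h.torsion k j
  have t0 := congrFun t 0
  have t1 := congrFun t 1
  have t2 := congrFun t 2
  simp only [frameCov, Matrix.cons_val_zero, Matrix.cons_val_one, Matrix.cons_val] at t0 t1 t2
  fin_cases α <;>
    simp [frameCov, Fin.sum_univ_three, hc k j]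
  -- Differentiating the connection terms leaves `Dₖeⱼ - Dⱼeₖ`, which the torsion equations express
  -- without derivatives.
  · linear_combination W 2 * t0
  · linear_combination -W 2 * t1
  · linear_combination -W 0 * t0 + W 1 * t1

/-- `e 0, e 1, n` and the inverse metric resolve the identity. -/
theorem completeness (h : IsSolFrame D e n) (hG : ∀ i j, ∑ m, frameMetric e i m * G m j
    = if i = j then 1 else 0) (α β : Fin 3) :
    ∑ i, ∑ j, G i j * e i α * e j β + n α * n β = if α = β then 1 else 0 := by
  -- The metric relations and the normality of `n` say `E (Eᵀ P) = 1`. For square matrices over a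
  -- commutative ring this gives `(Eᵀ P) E = 1`, which is the resolution of the identity.
  let E : Matrix (Fin 3) (Fin 3) R := Matrix.of ![e 0, e 1, n]
  let P : Matrix (Fin 3) (Fin 3) R := !![G 0 0, G 0 1, 0; G 1 0, G 1 1, 0; 0, 0, 1]
  have h00 := hG 0 0
  have h01 := hG 0 1
  have h10 := hG 1 0
  have h11 := hG 1 1
  have n0 := h.normal 0
  have n1 := h.normal 1
  have nn := h.unit
  simp only [frameMetric, Fin.sum_univ_two, Fin.sum_univ_three, if_true, zero_ne_one,
    one_ne_zero, if_false] at h00 h01 h10 h11 n0 n1 nn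
  have h1 : E * (E.transpose * P) = 1 := by
    ext a b
    fin_cases a <;> fin_cases b <;>
      simp [E, P, Matrix.mul_apply, Fin.sum_univ_three]
    · linear_combination h00
    · linear_combination h01
    · linear_combination n0
    · linear_combination h10
    · linear_combination h11
    · linear_combination n1
    · linear_combination G 0 0 * n0 + G 1 0 * n1
    · linear_combination G 0 1 * n0 + G 1 1 * n1
    · linear_combination nn
  have h2 := congrArg (fun M => M α β) (mul_eq_one_comm.mp h1)
  simp only [Matrix.one_apply] at h2
  rw [← h2]
  simp [E, P, Matrix.mul_apply, Fin.sum_univ_three, Fin.sum_univ_two]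
  ring

theorem expand (h : IsSolFrame D e n) (hG : ∀ i j, ∑ m, frameMetric e i m * G m j
    = if i = j then 1 else 0) (W : Fin 3 → R) (α : Fin 3) :
    W α = ∑ i, (∑ j, G i j * ∑ β, W β * e j β) * e i α + (∑ β, W β * n β) * n α := by
  have h1 := fun β => h.completeness hG α β
  have h2 : W α = ∑ β, (if α = β then 1 else 0) * W β := by simp
  rw [h2]
  simp only [← h1]
  simp only [Fin.sum_univ_three, Fin.sum_univ_two]
  ring

/-- Differentiate `⟨eⱼ, n⟩ = 0`. In this form the symmetry of the second fundamental form follows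
from vanishing torsion. -/
theorem frameSecond_eq (h : IsSolFrame D e n) (i j : Fin 2) :
    frameSecond D e n i j = ∑ α, frameCov D e (e j) i α * n α := by
  have h1 := frameCov_compat D e (e j) n i
  rw [h.normal, map_zero] at h1
  have h2 : ∑ α, e j α * frameCov D e n i α = ∑ α, frameCov D e n i α * e j α :=
    Finset.sum_congr rfl fun α _ => mul_comm _ _
  rw [h2] at h1
  rw [frameSecond]
  linear_combination h1

theorem frameSecond_symm (h : IsSolFrame D e n) (i j : Fin 2) :
    frameSecond D e n i j = frameSecond D e n j i := by
  rw [h.frameSecond_eq, h.frameSecond_eq, h.torsion]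

theorem lower_frameShape (hL : IsLeviCivita D (frameMetric e) G Γ) (i j : Fin 2) :
    ∑ l, frameMetric e i l * frameShape D G e n l j = frameSecond D e n j i :=
  hL.sum_lower_mul_inv (fun k => frameSecond D e n j k) i

theorem frameShape_symm (h : IsSolFrame D e n) (hL : IsLeviCivita D (frameMetric e) G Γ)
    (i j : Fin 2) :
    ∑ l, frameMetric e i l * frameShape D G e n l j
      = ∑ l, frameMetric e j l * frameShape D G e n l i := by
  rw [lower_frameShape hL, lower_frameShape hL, h.frameSecond_symm]

/-- Differentiating `⟨n, n⟩ = 1` shows that the derivative of `n` has no normal part; its tangential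
part is `-S` by definition. -/
theorem weingarten (h : IsSolFrame D e n) (hL : IsLeviCivita D (frameMetric e) G Γ)
    (j : Fin 2) (α : Fin 3) :
    frameCov D e n j α = -∑ i, frameShape D G e n i j * e i α := by
  have h1 := frameCov_compat D e n n j
  rw [h.unit, Derivation.map_one_eq_zero] at h1
  have h2 : ∑ β, n β * frameCov D e n j β = ∑ β, frameCov D e n j β * n β :=
    Finset.sum_congr rfl fun β _ => mul_comm _ _
  rw [h2] at h1
  have h3 := eq_zero_of_two_mul ((two_mul _).trans h1.symm)
  rw [h.expand hL.mul_inv (frameCov D e n j) α, h3]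
  simp only [frameShape, frameSecond, Fin.sum_univ_two]
  ring

/-- The tangential part of `∇̄ₖ eᵢ` is given by the Levi-Civita connection of the surface. -/
theorem frameCov_inner (h : IsSolFrame D e n) (hL : IsLeviCivita D (frameMetric e) G Γ)
    (k i j : Fin 2) :
    ∑ α, frameCov D e (e i) k α * e j α = ∑ l, frameMetric e j l * Γ l k i := by
  -- Koszul's argument: the difference `X` is symmetric in its first two indices (torsion) and skew
  -- in its last two (compatibility), hence zero.
  set X : Fin 2 → Fin 2 → Fin 2 → R := fun k i j =>
    ∑ α, frameCov D e (e i) k α * e j α - ∑ l, frameMetric e j l * Γ l k i with hX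
  have s1 : ∀ k i j, X k i j = X i k j := fun k i j => by
    simp only [hX, h.torsion k i, fun l => hL.torsion l k i]
  have s2 : ∀ k i j, X k i j + X k j i = 0 := fun k i j => by
    have h1 := frameCov_compat D e (e i) (e j) k
    have h2 := hL.compat k i j
    rw [frameMetric, h1] at h2
    have h3 : ∑ α, e i α * frameCov D e (e j) k α = ∑ α, frameCov D e (e j) k α * e i α :=
      Finset.sum_congr rfl fun α _ => mul_comm _ _
    have h4 : ∑ l, (frameMetric e l j * Γ l k i + frameMetric e i l * Γ l k j)
        = ∑ l, frameMetric e j l * Γ l k i + ∑ l, frameMetric e i l * Γ l k j := by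
      rw [← Finset.sum_add_distrib]
      exact Finset.sum_congr rfl fun l _ => by rw [hL.symm l j]
    rw [h3, h4] at h2
    simp only [hX]
    linear_combination h2
  have h3 : 2 * X k i j = 0 := by
    linear_combination s2 k i j - s1 k j i - s2 j k i + s1 j i k + s2 i j k - s1 i k j
  exact sub_eq_zero.mp (eq_zero_of_two_mul h3)

theorem gauss (h : IsSolFrame D e n) (hL : IsLeviCivita D (frameMetric e) G Γ)
    (k i : Fin 2) (α : Fin 3) :
    frameCov D e (e i) k α = ∑ l, Γ l k i * e l α + frameSecond D e n k i * n α := by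
  rw [h.expand hL.mul_inv (frameCov D e (e i) k) α, ← h.frameSecond_eq]
  congr 1
  refine Finset.sum_congr rfl fun l _ => ?_
  simp only [h.frameCov_inner hL]
  rw [hL.sum_inv_mul_lower (fun m => Γ m k i) l]

theorem frameCov_neg_sum (D : Fin 2 → Derivation ℝ R R) (e : Fin 2 → Fin 3 → R)
    (c : Fin 2 → R) (V : Fin 2 → Fin 3 → R) (k : Fin 2) (α : Fin 3) :
    frameCov D e (fun α => -∑ i, c i * V i α) k α
      = -∑ i, (D k (c i) * V i α + c i * frameCov D e (V i) k α) := by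
  fin_cases α <;>
    simp [frameCov, Fin.sum_univ_two] <;> ring

/-- This is the tangential part of the Ricci identity applied to `n`. Since `⟨eⱼ, n⟩ = 0`, only the
terms of the ambient curvature that involve `E₃` survive. -/
theorem codazzi (h : IsSolFrame D e n) (hL : IsLeviCivita D (frameMetric e) G Γ)
    (k i j : Fin 2) :
    covMixed D Γ (frameShape D G e n) k i j - covMixed D Γ (frameShape D G e n) j i k
      = -2 * ((if i = j then n 2 * e k 2 else 0) - (if i = k then n 2 * e j 2 else 0)) := by
  set S := frameShape D G e n with hS
  have hW : ∀ j, frameCov D e n j = fun α => -∑ i, S i j * e i α := fun j =>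
    funext fun α => h.weingarten hL j α
  -- Weingarten and Gauss expand the second derivatives of `n`; the connection terms symmetric in
  -- `k, j` cancel. Pairing with `eₘ` in `h3` then removes the multiple of `n`.
  have h1 : ∀ α, ∑ i, (covMixed D Γ S k i j - covMixed D Γ S j i k) * e i α
      + (∑ i, (S i j * frameSecond D e n k i - S i k * frameSecond D e n j i)) * n α
      = 2 * (n 2 * e j 2 * e k α - n 2 * e k 2 * e j α) := by
    intro α
    have h2 := h.frameCov_comm hL.comm n k j α
    rw [hW, hW, frameCov_neg_sum, frameCov_neg_sum, h.normal, h.normal] at h2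
    simp only [h.gauss hL] at h2
    simp only [zero_mul, sub_zero, ite_self, add_zero, zero_sub] at h2
    simp only [covMixed, Fin.sum_univ_two, hL.torsion _ j k] at h2 ⊢
    linear_combination -h2
  have h3 : ∀ m, ∑ i, frameMetric e m i * (covMixed D Γ S k i j - covMixed D Γ S j i k)
      = 2 * (n 2 * e j 2 * frameMetric e m k - n 2 * e k 2 * frameMetric e m j) := by
    intro m
    have h4 := h.normal m
    have a0 := h1 0
    have a1 := h1 1
    have a2 := h1 2
    simp only [frameMetric, Fin.sum_univ_two, Fin.sum_univ_three] at h4 a0 a1 a2 ⊢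
    linear_combination e m 0 * a0 + e m 1 * a1 + e m 2 * a2
      - (S 0 j * frameSecond D e n k 0 - S 0 k * frameSecond D e n j 0
        + (S 1 j * frameSecond D e n k 1 - S 1 k * frameSecond D e n j 1)) * h4
  rw [← hL.sum_inv_mul_lower (fun i => covMixed D Γ S k i j - covMixed D Γ S j i k) i]
  simp only [h3]
  have h4 := hL.inv_mul i k
  have h5 := hL.inv_mul i j
  have h6 : ∑ m, G i m * (2 * (n 2 * e j 2 * frameMetric e m k - n 2 * e k 2 * frameMetric e m j))
      = 2 * (n 2 * e j 2 * (∑ m, G i m * frameMetric e m k)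
        - n 2 * e k 2 * ∑ m, G i m * frameMetric e m j) := by
    simp only [Fin.sum_univ_two]; ring
  rw [h6, h4, h5]
  split_ifs <;> ring

/-- Simons' formula for surfaces of constant mean curvature in `Sol₃`. -/
theorem simons (h : IsSolFrame D e n) (hL : IsLeviCivita D (frameMetric e) G Γ) {κ : R}
    (hκ : ∑ l, frameMetric e l 0 * ringCurvature D Γ l 0 1 1
      = κ * (frameMetric e 0 0 * frameMetric e 1 1 - frameMetric e 0 1 * frameMetric e 1 0))
    {S : Fin 2 → Fin 2 → R} (hS : S = frameShape D G e n)
    {B : Fin 2 → R} (hB : B = fun i => n 2 * ∑ k, G i k * e k 2)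
    (htr : ∀ k, D k (∑ i, S i i) = 0) :
    ringDiv D Γ (fun l => ∑ k, G l k * D k (∑ i, ∑ j, S i j * S j i))
      = 2 * (∑ k, ∑ m, ∑ a, ∑ b, ∑ j, ∑ l, G k m * frameMetric e a b * G j l *
          covMixed D Γ S k a j * covMixed D Γ S m b l)
        + 8 * ringDiv D Γ (fun l => ∑ m, S l m * B m)
        - 4 * ((∑ i, S i i) * ringDiv D Γ B)
        + 2 * κ * (2 * (∑ i, ∑ j, S i j * S j i) - (∑ i, S i i) * (∑ i, S i i))
        - 16 * (n 2 * n 2 * (1 - n 2 * n 2)) := by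
  subst hS
  have hb : ∀ k, n 2 * e k 2 = ∑ l, frameMetric e k l * B l := by
    intro k
    have h1 := hL.sum_lower_mul_inv (fun k => e k 2) k
    rw [hB]
    simp only [Fin.sum_univ_two] at h1 ⊢
    linear_combination -n 2 * h1
  rw [hL.laplacian_trace_sq_of_codazzi hκ (h.frameShape_symm hL) htr hb (h.codazzi hL)]
  have h2 := h.completeness hL.mul_inv 2 2
  -- The `(2,2)` entry of the resolution of the identity is `|E₃^⊤|² = 1 - ν²`.
  have h3 : ∑ k, n 2 * e k 2 * B k = n 2 * n 2 * (1 - n 2 * n 2) := by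
    rw [hB]
    simp only [Fin.sum_univ_two, if_true] at h2 ⊢
    linear_combination n 2 * n 2 * h2
  rw [h3]

end IsSolFrame

end Frame

/-! ### The ring of smooth functions on a coordinate domain -/

section SmoothRing

open Topology

theorem pderiv_congr {n : ℕ} {i : Fin n} {h k : Coord n → ℝ} {u : Coord n} (e : h =ᶠ[𝓝 u] k) :
    pderiv i h u = pderiv i k u := by
  rw [pderiv, pderiv, e.fderiv_eq]

theorem ContDiffOn.pderiv {n : ℕ} {U : Set (Coord n)} (hU : IsOpen U) {h : Coord n → ℝ}
    (hh : ContDiffOn ℝ ∞ h U) (i : Fin n) : ContDiffOn ℝ ∞ (pderiv i h) U :=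
  (hh.fderiv_of_isOpen hU (m := ∞) (by simp)).clm_apply contDiffOn_const

theorem pderiv_comm {n : ℕ} {h : Coord n → ℝ} {u : Coord n} (hh : ContDiffAt ℝ ∞ h u)
    (i j : Fin n) : pderiv i (pderiv j h) u = pderiv j (pderiv i h) u := by
  have hd : DifferentiableAt ℝ (fderiv ℝ h) u :=
    (hh.fderiv_right (m := 1) (by norm_cast)).differentiableAt (by simp)
  have key : ∀ a b : Fin n, pderiv a (pderiv b h) u
      = fderiv ℝ (fderiv ℝ h) u (stdVec a) (stdVec b) := by
    intro a b
    change fderiv ℝ (fun x => fderiv ℝ h x (stdVec b)) u (stdVec a) = _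
    rw [fderiv_clm_apply hd (differentiableAt_const _)]
    simp
  rw [key, key]
  exact (hh.isSymmSndFDerivAt (by simp; norm_cast)).eq _ _

variable (U : TopologicalSpace.Opens (Coord 2))

open Classical in
/-- Extension by zero of a function on `U`. -/
def zeroExt (h : U → ℝ) (x : Coord 2) : ℝ := if hx : x ∈ U then h ⟨x, hx⟩ else 0

variable {U}

theorem zeroExt_apply (h : U → ℝ) (u : U) : zeroExt U h u = h u := by
  simp [zeroExt]

theorem zeroExt_of_mem (h : U → ℝ) {u : Coord 2} (hu : u ∈ U) : zeroExt U h u = h ⟨u, hu⟩ := by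
  simp [zeroExt, hu]

variable (U)

/-- The algebra of smooth functions on `U`. -/
def smoothRing : Subalgebra ℝ (U → ℝ) where
  carrier := {h | ContDiffOn ℝ ∞ (zeroExt U h) U}
  mul_mem' {a b} ha hb := (ContDiffOn.mul ha hb).congr fun u hu => by
    simp [zeroExt_of_mem _ hu]
  add_mem' {a b} ha hb := (ContDiffOn.add ha hb).congr fun u hu => by
    simp [zeroExt_of_mem _ hu]
  algebraMap_mem' c := (contDiffOn_const (c := c)).congr fun u hu => by
    simp [zeroExt_of_mem _ hu]

variable {U}

/-- The element `x` of `smoothRing U` is the restriction of `H`. -/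
def IsRestr (x : smoothRing U) (H : Coord 2 → ℝ) : Prop := ∀ u : U, x.1 u = H u

theorem IsRestr.eqOn {x : smoothRing U} {H : Coord 2 → ℝ} (h : IsRestr x H) :
    Set.EqOn (zeroExt U x.1) H U := fun u hu => by
  rw [zeroExt_of_mem _ hu, h]

theorem IsRestr.contDiffOn {x : smoothRing U} {H : Coord 2 → ℝ} (h : IsRestr x H) :
    ContDiffOn ℝ ∞ H U :=
  ContDiffOn.congr x.2 h.eqOn.symm

theorem IsRestr.eventuallyEq {x : smoothRing U} {H : Coord 2 → ℝ} (h : IsRestr x H) (u : U) :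
    zeroExt U x.1 =ᶠ[𝓝 (u : Coord 2)] H :=
  Filter.eventuallyEq_of_mem (U.isOpen.mem_nhds u.2) h.eqOn

theorem isRestr_zeroExt (x : smoothRing U) : IsRestr x (zeroExt U x.1) := fun u =>
  (zeroExt_apply _ u).symm

theorem smoothRing_differentiableAt (x : smoothRing U) (u : U) :
    DifferentiableAt ℝ (zeroExt U x.1) u :=
  (ContDiffOn.contDiffAt x.2 (U.isOpen.mem_nhds u.2)).differentiableAt (by simp)

/-- Restriction of a smooth function. -/
def restr (H : Coord 2 → ℝ) (hH : ContDiffOn ℝ ∞ H U) : smoothRing U :=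
  ⟨fun u => H u, hH.congr fun u hu => by rw [zeroExt_of_mem _ hu]⟩

theorem isRestr_restr (H : Coord 2 → ℝ) (hH : ContDiffOn ℝ ∞ H U) : IsRestr (restr H hH) H :=
  fun _ => rfl

variable (U) in
/-- Partial derivatives as derivations of `smoothRing U`. -/
def partialDer (i : Fin 2) : Derivation ℝ (smoothRing U) (smoothRing U) :=
  Derivation.mk'
    { toFun := fun x => restr (pderiv i (zeroExt U x.1)) (ContDiffOn.pderiv U.isOpen x.2 i)
      map_add' := fun x y => by
        ext u
        change pderiv i (zeroExt U (x + y).1) u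
          = pderiv i (zeroExt U x.1) u + pderiv i (zeroExt U y.1) u
        have h : IsRestr (x + y) (zeroExt U x.1 + zeroExt U y.1) := fun u => by
          simp [zeroExt_apply]
        rw [pderiv_congr (h.eventuallyEq u), pderiv, fderiv_add (smoothRing_differentiableAt x u)
          (smoothRing_differentiableAt y u)]
        rfl
      map_smul' := fun c x => by
        ext u
        change pderiv i (zeroExt U (c • x).1) u = c * pderiv i (zeroExt U x.1) u
        have h : IsRestr (c • x) (c • zeroExt U x.1) := fun u => by
          simp [zeroExt_apply]
        rw [pderiv_congr (h.eventuallyEq u), pderiv, fderiv_const_smul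
          (smoothRing_differentiableAt x u)]
        rfl }
    fun x y => by
      ext u
      change pderiv i (zeroExt U (x * y).1) u
        = x.1 u * pderiv i (zeroExt U y.1) u + y.1 u * pderiv i (zeroExt U x.1) u
      have h : IsRestr (x * y) (zeroExt U x.1 * zeroExt U y.1) := fun u => by
        simp [zeroExt_apply]
      rw [pderiv_congr (h.eventuallyEq u), pderiv, fderiv_mul (smoothRing_differentiableAt x u)
        (smoothRing_differentiableAt y u), zeroExt_apply, zeroExt_apply]
      rfl

/-- Differentiation is local and `U` is open, so the values of `H` off `U` play no role. -/
theorem IsRestr.partialDer {x : smoothRing U} {H : Coord 2 → ℝ} (h : IsRestr x H) (i : Fin 2) :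
    IsRestr (partialDer U i x) (pderiv i H) := fun u =>
  pderiv_congr (h.eventuallyEq u)

theorem partialDer_comm (i j : Fin 2) (x : smoothRing U) :
    partialDer U i (partialDer U j x) = partialDer U j (partialDer U i x) := by
  ext u
  rw [((isRestr_zeroExt x).partialDer j).partialDer i u,
    ((isRestr_zeroExt x).partialDer i).partialDer j u]
  exact pderiv_comm (ContDiffOn.contDiffAt x.2 (U.isOpen.mem_nhds u.2)) i j

/-- Evaluation at a point of `U`. -/
def evalAt (u : U) : smoothRing U →ₐ[ℝ] ℝ :=
  (Pi.evalAlgHom ℝ (fun _ : U => ℝ) u).comp (smoothRing U).val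

theorem smoothRing_ext {x y : smoothRing U} (h : ∀ u, evalAt u x = evalAt u y) : x = y :=
  Subtype.ext (funext h)

theorem IsRestr.evalAt {x : smoothRing U} {H : Coord 2 → ℝ} (h : IsRestr x H) (u : U) :
    evalAt u x = H u := h u

theorem isRestr_of_evalAt {x : smoothRing U} {H : Coord 2 → ℝ} (h : ∀ u, evalAt u x = H u) :
    IsRestr x H := h

theorem evalAt_restr (H : Coord 2 → ℝ) (hH : ContDiffOn ℝ ∞ H U) (u : U) :
    evalAt u (restr H hH) = H u := rfl

theorem evalAt_partialDer {x : smoothRing U} {H : Coord 2 → ℝ} (h : IsRestr x H) (i : Fin 2)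
    (u : U) : evalAt u (partialDer U i x) = pderiv i H u := h.partialDer i u

/-! ### Levi-Civita connection of a metric in coordinates -/

variable {g : Coord 2 → Matrix (Fin 2) (Fin 2) ℝ}

theorem sum_mul_christoffel {n : ℕ} {g : Coord n → Matrix (Fin n) (Fin n) ℝ} {u : Coord n}
    (hdet : (g u).det ≠ 0) (a i j : Fin n) :
    ∑ k, g u a k * christoffel g k i j u = (1 / 2) * (pderiv i (fun x => g x j a) u
      + pderiv j (fun x => g x i a) u - pderiv a (fun x => g x i j) u) := by
  have h := Matrix.mul_nonsing_inv (g u) (isUnit_iff_ne_zero.mpr hdet)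
  have h1 : ∀ l, ∑ k, g u a k * (g u)⁻¹ k l = if a = l then 1 else 0 := fun l => by
    have := congrArg (fun M => M a l) h
    simpa [Matrix.mul_apply, Matrix.one_apply] using this
  simp only [christoffel]
  set X : Fin n → ℝ := fun l => pderiv i (fun x => g x j l) u
      + pderiv j (fun x => g x i l) u - pderiv l (fun x => g x i j) u with hX
  change ∑ k, g u a k * (1 / 2 * ∑ l, (g u)⁻¹ k l * X l) = 1 / 2 * X a
  calc _ = 1 / 2 * ∑ l, (∑ k, g u a k * (g u)⁻¹ k l) * X l := by
        simp only [Finset.mul_sum, Finset.sum_mul]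
        rw [Finset.sum_comm]
        exact Finset.sum_congr rfl fun l _ => Finset.sum_congr rfl fun k _ => by ring
    _ = _ := by simp [h1]

theorem christoffel_symm {n : ℕ} {g : Coord n → Matrix (Fin n) (Fin n) ℝ}
    (hg : ∀ u i j, g u i j = g u j i) (k i j : Fin n) (u : Coord n) :
    christoffel g k i j u = christoffel g k j i u := by
  simp only [christoffel]
  refine congrArg _ (Finset.sum_congr rfl fun l _ => ?_)
  have : (fun x => g x i j) = fun x => g x j i := funext fun x => hg x i j
  rw [this]
  ring

theorem contDiffOn_inv {U : Set (Coord 2)} (hdet : ∀ u ∈ U, (g u).det ≠ 0)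
    (hg : ∀ i j, ContDiffOn ℝ ∞ (fun u => g u i j) U) (i j : Fin 2) :
    ContDiffOn ℝ ∞ (fun u => (g u)⁻¹ i j) U := by
  have hd : ContDiffOn ℝ ∞ (fun u => (g u).det⁻¹) U := by
    refine ContDiffOn.inv ?_ hdet
    simp only [Matrix.det_fin_two]
    exact ((hg 0 0).mul (hg 1 1)).sub ((hg 0 1).mul (hg 1 0))
  have h : ∀ u, (g u)⁻¹ i j = (g u).det⁻¹ * (g u).adjugate i j := fun u => by
    simp [Matrix.inv_def]
  simp only [h, Matrix.adjugate_fin_two]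
  refine hd.mul ?_
  fin_cases i <;> fin_cases j <;> simp
  · exact hg 1 1
  · exact (hg 0 1).neg
  · exact (hg 1 0).neg
  · exact hg 0 0

theorem contDiffOn_christoffel {U : Set (Coord 2)} (hU : IsOpen U)
    (hdet : ∀ u ∈ U, (g u).det ≠ 0)
    (hg : ∀ i j, ContDiffOn ℝ ∞ (fun u => g u i j) U) (k i j : Fin 2) :
    ContDiffOn ℝ ∞ (christoffel g k i j) U := by
  unfold christoffel
  refine contDiffOn_const.mul (ContDiffOn.sum fun l _ => (contDiffOn_inv hdet hg k l).mul ?_)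
  exact ((ContDiffOn.pderiv hU (hg j l) i).add (ContDiffOn.pderiv hU (hg i l) j)).sub
    (ContDiffOn.pderiv hU (hg i j) l)

/-- The coordinate Christoffel symbols give the Levi-Civita connection over `smoothRing U`. -/
theorem isLeviCivita_christoffel (hsymm : ∀ u i j, g u i j = g u j i)
    (hdet : ∀ u ∈ U, (g u).det ≠ 0) {gR GR : Fin 2 → Fin 2 → smoothRing U}
    {ΓR : Fin 2 → Fin 2 → Fin 2 → smoothRing U}
    (hg : ∀ i j, IsRestr (gR i j) fun u => g u i j)
    (hG : ∀ i j, IsRestr (GR i j) fun u => (g u)⁻¹ i j)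
    (hΓ : ∀ k i j, IsRestr (ΓR k i j) (christoffel g k i j)) :
    IsLeviCivita (partialDer U) gR GR ΓR where
  comm := partialDer_comm
  symm i j := smoothRing_ext fun u => by rw [(hg i j).evalAt, (hg j i).evalAt, hsymm]
  symm_inv i j := smoothRing_ext fun u => by
    rw [(hG i j).evalAt, (hG j i).evalAt]
    have : (g u).transpose = g u := Matrix.ext fun a b => hsymm u b a
    have h2 := congrArg (fun M => M j i) (Matrix.transpose_nonsing_inv (g u))
    rw [this] at h2
    exact h2
  mul_inv i j := smoothRing_ext fun u => by
    have h := Matrix.mul_nonsing_inv (g u) (isUnit_iff_ne_zero.mpr (hdet u u.2))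
    have h1 := congrArg (fun M => M i j) h
    simp only [Matrix.mul_apply, Matrix.one_apply] at h1
    simp only [map_sum, map_mul, (hg _ _).evalAt, (hG _ _).evalAt, h1]
    split_ifs <;> simp
  torsion k i j := smoothRing_ext fun u => by
    rw [(hΓ k i j).evalAt, (hΓ k j i).evalAt, christoffel_symm hsymm]
  compat k i j := smoothRing_ext fun u => by
    rw [evalAt_partialDer (hg i j)]
    -- Adding the two lowered Christoffel symbols cancels all derivatives of the metric except `∂ₖ
    -- gᵢⱼ`, which occurs twice with factor one half.
    have h1 := sum_mul_christoffel (hdet u u.2) j k i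
    have h2 := sum_mul_christoffel (hdet u u.2) i k j
    have e : ∀ a b, (fun x => g x a b) = fun x => g x b a := fun a b =>
      funext fun x => hsymm x a b
    rw [e j i] at h2
    simp only [map_sum, map_add, map_mul, (hg _ _).evalAt, (hΓ _ _ _).evalAt,
      Finset.sum_add_distrib, hsymm u _ j, h1, h2]
    ring

variable {gR GR : Fin 2 → Fin 2 → smoothRing U} {ΓR : Fin 2 → Fin 2 → Fin 2 → smoothRing U}

theorem evalAt_ringDiv (hΓ : ∀ k i j, IsRestr (ΓR k i j) (christoffel g k i j))
    {VR : Fin 2 → smoothRing U} {V : Fin 2 → Coord 2 → ℝ} (hV : ∀ i, IsRestr (VR i) (V i))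
    (u : U) : evalAt u (ringDiv (partialDer U) ΓR VR) = coordDiv g V u := by
  simp only [ringDiv, coordDiv, map_add, map_sum, map_mul, evalAt_partialDer (hV _),
    (hV _).evalAt, (hΓ _ _ _).evalAt]

theorem evalAt_covMixed (hΓ : ∀ k i j, IsRestr (ΓR k i j) (christoffel g k i j))
    {SR : Fin 2 → Fin 2 → smoothRing U} {S : Fin 2 → Fin 2 → Coord 2 → ℝ}
    (hS : ∀ i j, IsRestr (SR i j) (S i j)) (k i j : Fin 2) (u : U) :
    evalAt u (covMixed (partialDer U) ΓR SR k i j) = coordCovDeriv g S k i j u := by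
  simp only [covMixed, coordCovDeriv, map_add, map_sub, map_sum, map_mul,
    evalAt_partialDer (hS _ _), (hS _ _).evalAt, (hΓ _ _ _).evalAt]

theorem evalAt_ringCurvature (hΓ : ∀ k i j, IsRestr (ΓR k i j) (christoffel g k i j))
    (l i j k : Fin 2) (u : U) :
    evalAt u (ringCurvature (partialDer U) ΓR l i j k) = curvature g l i j k u := by
  simp only [ringCurvature, curvature, map_add, map_sub, map_sum, map_mul,
    evalAt_partialDer (hΓ _ _ _), (hΓ _ _ _).evalAt]

end SmoothRing

/-! ### Parametrized surfaces in `Sol₃` -/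

section Parametrized

/-- Components of `v`, a tangent vector at `x`, in the orthonormal frame of `Sol₃`. -/
def frameVec (x v : Coord 3) : Fin 3 → ℝ :=
  ![Real.exp (x 2) * v 0, Real.exp (-x 2) * v 1, v 2]

theorem solInner_eq (x v w : Coord 3) : solInner x v w
    = Real.exp (x 2) * Real.exp (x 2) * v 0 * w 0
      + Real.exp (-x 2) * Real.exp (-x 2) * v 1 * w 1 + v 2 * w 2 := by
  rw [← Real.exp_add, ← Real.exp_add]
  simp [solInner, solMetric, Fin.sum_univ_three, Matrix.diagonal_apply]
  ring_nf

theorem solInner_eq_frameVec (x v w : Coord 3) :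
    solInner x v w = ∑ α, frameVec x v α * frameVec x w α := by
  rw [solInner_eq]
  simp [frameVec, Fin.sum_univ_three]
  ring

theorem pderiv_solMetric (l i j : Fin 3) (x : Coord 3) :
    pderiv l (fun y => solMetric y i j) x
      = if i = j ∧ l = 2 then ![2 * Real.exp (2 * x 2), -2 * Real.exp (-2 * x 2), 0] i else 0 := by
  have hp : HasFDerivAt (fun y : Coord 3 => y 2) (EuclideanSpace.proj (𝕜 := ℝ) (2 : Fin 3)) x :=
    (EuclideanSpace.proj (𝕜 := ℝ) (2 : Fin 3)).hasFDerivAt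
  by_cases hij : i = j
  · subst hij
    have h0 : HasFDerivAt (fun y : Coord 3 => Real.exp (2 * y 2)) _ x := (hp.const_mul 2).exp
    have h1 : HasFDerivAt (fun y : Coord 3 => Real.exp (-2 * y 2)) _ x := (hp.const_mul (-2)).exp
    fin_cases i
    · simp only [pderiv, solMetric, Matrix.diagonal_apply_eq, Fin.zero_eta, Matrix.cons_val_zero]
      rw [h0.fderiv]
      fin_cases l <;> simp [stdVec]
      ring
    · simp only [pderiv, solMetric, Matrix.diagonal_apply_eq, Fin.mk_one, Matrix.cons_val_one,
        Matrix.cons_val_zero]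
      rw [h1.fderiv]
      fin_cases l <;> simp [stdVec]
      ring
    · simp [pderiv, solMetric]
  · simp [pderiv, solMetric, hij]

theorem solMetric_inv (x : Coord 3) : (solMetric x)⁻¹
    = Matrix.diagonal ![Real.exp (-2 * x 2), Real.exp (2 * x 2), 1] := by
  apply Matrix.inv_eq_right_inv
  rw [solMetric, Matrix.diagonal_mul_diagonal, ← Matrix.diagonal_one]
  congr 1
  ext i
  fin_cases i <;> simp [← Real.exp_add]

theorem christoffel_solMetric (k i j : Fin 3) (x : Coord 3) :
    christoffel solMetric k i j x
      = (1 / 2) * ![Real.exp (-2 * x 2), Real.exp (2 * x 2), 1] k *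
        (pderiv i (fun y => solMetric y j k) x + pderiv j (fun y => solMetric y i k) x
          - pderiv k (fun y => solMetric y i j) x) := by
  rw [christoffel, solMetric_inv, Finset.sum_eq_single k]
  · rw [Matrix.diagonal_apply_eq]; ring
  · intro l _ hl
    rw [Matrix.diagonal_apply_ne _ hl.symm, zero_mul]
  · simp

/-- The ambient covariant derivative in the orthonormal frame. -/
theorem frameVec_covariant (x v W dW : Coord 3) :
    frameVec x (WithLp.toLp 2 fun k => dW k
        + ∑ i, ∑ j, christoffel solMetric k i j x * v i * W j)
      = ![Real.exp (x 2) * (dW 0 + v 2 * W 0 + v 0 * W 2),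
          Real.exp (-x 2) * (dW 1 - v 2 * W 1 - v 1 * W 2),
          dW 2 - Real.exp (x 2) * Real.exp (x 2) * v 0 * W 0
            + Real.exp (-x 2) * Real.exp (-x 2) * v 1 * W 1] := by
  have h1 : Real.exp (-(2 * x 2)) * Real.exp (2 * x 2) = 1 := by
    rw [← Real.exp_add]; simp
  have h2 : Real.exp (x 2) * Real.exp (x 2) = Real.exp (2 * x 2) := by
    rw [← Real.exp_add]; ring_nf
  have h3 : Real.exp (-x 2) * Real.exp (-x 2) = Real.exp (-2 * x 2) := by
    rw [← Real.exp_add]; ring_nf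
  rw [h2, h3]
  ext k
  fin_cases k <;>
    simp only [frameVec, christoffel_solMetric, pderiv_solMetric, Fin.sum_univ_three] <;> simp
  · linear_combination (v 2 * W 0 + v 0 * W 2) * h1
  · linear_combination -(v 2 * W 1 + v 1 * W 2) * h1
  · ring

/-! ### Parametrized surfaces as frames over the ring of smooth functions -/

variable (F N : Coord 2 → Coord 3)

/-- Induced metric of a parametrized surface. -/
def paramMetric (u : Coord 2) : Matrix (Fin 2) (Fin 2) ℝ :=
  Matrix.of fun i j => solInner (F u) (fderiv ℝ F u (stdVec i)) (fderiv ℝ F u (stdVec j))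

/-- Covariant derivative of the field `N` in the coordinate direction `j`. -/
def paramCov (j : Fin 2) (u : Coord 2) : Coord 3 :=
  WithLp.toLp 2 fun k => fderiv ℝ N u (stdVec j) k
    + ∑ a, ∑ b, christoffel solMetric k a b (F u) * fderiv ℝ F u (stdVec j) a * N u b

/-- Components of the tangential part of `w`. -/
def paramTan (i : Fin 2) (u : Coord 2) (w : Coord 3) : ℝ :=
  ∑ k, (paramMetric F u)⁻¹ i k * solInner (F u) w (fderiv ℝ F u (stdVec k))

/-- Components of the shape operator. -/
def paramShape (i j : Fin 2) (u : Coord 2) : ℝ := paramTan F i u (-paramCov F N j u)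

variable {F N} {U : TopologicalSpace.Opens (Coord 2)}

theorem contDiffOn_apply (hF : ContDiffOn ℝ ∞ F U) (k : Fin 3) :
    ContDiffOn ℝ ∞ (fun u => F u k) U :=
  (EuclideanSpace.proj (𝕜 := ℝ) k).contDiff.comp_contDiffOn hF

theorem differentiableAt_of_mem {G : Type*} [NormedAddCommGroup G] [NormedSpace ℝ G]
    {H : Coord 2 → G} (hH : ContDiffOn ℝ ∞ H U) (u : U) : DifferentiableAt ℝ H u :=
  (hH.contDiffAt (U.isOpen.mem_nhds u.2)).differentiableAt (by simp)

theorem fderiv_apply_eq_pderiv (hF : ContDiffOn ℝ ∞ F U) (u : U) (j : Fin 2) (k : Fin 3) :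
    fderiv ℝ F u (stdVec j) k = pderiv j (fun x => F x k) u := by
  have := ((EuclideanSpace.proj (𝕜 := ℝ) k).hasFDerivAt.comp (u : Coord 2)
    (differentiableAt_of_mem hF u).hasFDerivAt).fderiv
  rw [pderiv]
  exact (congrArg (fun L => L (stdVec j)) this).symm

theorem contDiffOn_fderiv_apply (hF : ContDiffOn ℝ ∞ F U) (j : Fin 2) :
    ContDiffOn ℝ ∞ (fun u => fderiv ℝ F u (stdVec j)) U :=
  (hF.fderiv_of_isOpen U.isOpen (m := ∞) (by simp)).clm_apply contDiffOn_const

theorem contDiffOn_frameVec {W : Coord 2 → Coord 3} (hF : ContDiffOn ℝ ∞ F U)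
    (hW : ContDiffOn ℝ ∞ W U) (α : Fin 3) :
    ContDiffOn ℝ ∞ (fun u => frameVec (F u) (W u) α) U := by
  fin_cases α
  · exact (contDiffOn_apply hF 2).exp.mul (contDiffOn_apply hW 0)
  · exact (contDiffOn_apply hF 2).neg.exp.mul (contDiffOn_apply hW 1)
  · exact contDiffOn_apply hW 2

theorem pderiv_exp_mul {z h : Coord 2 → ℝ} (hz : ContDiffOn ℝ ∞ z U) (hh : ContDiffOn ℝ ∞ h U)
    (k : Fin 2) (u : U) : pderiv k (fun x => Real.exp (z x) * h x) u
      = Real.exp (z u) * (pderiv k h u + pderiv k z u * h u) := by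
  have := ((differentiableAt_of_mem hz u).hasFDerivAt.exp.mul
    (differentiableAt_of_mem hh u).hasFDerivAt).fderiv
  simp only [pderiv]
  refine (congrArg (fun L => L (stdVec k)) this).trans ?_
  simp
  ring

theorem pderiv_neg {z : Coord 2 → ℝ} (k : Fin 2) (u : Coord 2) :
    pderiv k (fun x => -z x) u = -pderiv k z u := by
  simp [pderiv]

/-- The ring elements given by the frame components of a field along the surface. -/
def frameRestr {W : Coord 2 → Coord 3} (hF : ContDiffOn ℝ ∞ F U) (hW : ContDiffOn ℝ ∞ W U)
    (α : Fin 3) : smoothRing U :=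
  restr (fun u => frameVec (F u) (W u) α) (contDiffOn_frameVec hF hW α)

/-- The ring elements given by the frame components of the coordinate fields. -/
def coordRestr (hF : ContDiffOn ℝ ∞ F U) (j : Fin 2) (α : Fin 3) : smoothRing U :=
  frameRestr hF (contDiffOn_fderiv_apply hF j) α

/-- Differentiating the factors `e^{±z}` of the frame components yields exactly the Christoffel
terms of `Sol₃` absent from `frameCov`. -/
theorem evalAt_frameCov {W : Coord 2 → Coord 3} (hF : ContDiffOn ℝ ∞ F U)
    (hW : ContDiffOn ℝ ∞ W U) (k : Fin 2) (α : Fin 3) (u : U) :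
    evalAt u (frameCov (partialDer U) (coordRestr hF) (frameRestr hF hW) k α)
      = frameVec (F u) (paramCov F W k u) α := by
  have hd : ∀ α, evalAt u (partialDer U k (frameRestr hF hW α))
      = pderiv k (fun u => frameVec (F u) (W u) α) u := fun α =>
    evalAt_partialDer (isRestr_restr _ (contDiffOn_frameVec hF hW α)) k u
  have h0 : pderiv k (fun u => frameVec (F u) (W u) 0) u = _ :=
    pderiv_exp_mul (contDiffOn_apply hF 2) (contDiffOn_apply hW 0) k u
  have h1 : pderiv k (fun u => frameVec (F u) (W u) 1) u = _ :=
    pderiv_exp_mul (contDiffOn_apply hF 2).neg (contDiffOn_apply hW 1) k u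
  have he : ∀ j α, evalAt u (coordRestr hF j α)
      = frameVec (F u) (fderiv ℝ F u (stdVec j)) α := fun _ _ => rfl
  have hn : ∀ α, evalAt u (frameRestr hF hW α) = frameVec (F u) (W u) α := fun _ => rfl
  rw [pderiv_neg] at h1
  rw [paramCov, frameVec_covariant]
  simp only [fderiv_apply_eq_pderiv hF, fderiv_apply_eq_pderiv hW] at he ⊢
  fin_cases α <;> simp [frameCov, hd, h0, h1, he, hn]
  · simp [frameVec, fderiv_apply_eq_pderiv hF]
    ring
  · simp [frameVec, fderiv_apply_eq_pderiv hF]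
    ring
  · simp [frameVec, fderiv_apply_eq_pderiv hF]
    ring

/-- Second partial derivatives of `F` commute and the Christoffel symbols of `Sol₃` are symmetric;
this supplies the torsion condition of `IsSolFrame`. -/
theorem paramCov_fderiv_symm (hF : ContDiffOn ℝ ∞ F U) (k j : Fin 2) (u : U) :
    frameVec (F u) (paramCov F (fun u => fderiv ℝ F u (stdVec j)) k u)
      = frameVec (F u) (paramCov F (fun u => fderiv ℝ F u (stdVec k)) j u) := by
  have hs : ∀ α, fderiv ℝ (fun u => fderiv ℝ F u (stdVec j)) u (stdVec k) α
      = fderiv ℝ (fun u => fderiv ℝ F u (stdVec k)) u (stdVec j) α := by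
    intro α
    have key : ∀ j k, fderiv ℝ (fun u => fderiv ℝ F u (stdVec j)) u (stdVec k) α
        = pderiv k (pderiv j fun x => F x α) u := fun j k => by
      rw [fderiv_apply_eq_pderiv (contDiffOn_fderiv_apply hF j)]
      refine pderiv_congr (Filter.eventuallyEq_of_mem (U.isOpen.mem_nhds u.2) fun v hv => ?_)
      exact fderiv_apply_eq_pderiv hF ⟨v, hv⟩ j α
    rw [key, key]
    exact pderiv_comm ((contDiffOn_apply hF α).contDiffAt (U.isOpen.mem_nhds u.2)) k j
  rw [paramCov, paramCov, frameVec_covariant, frameVec_covariant, hs 0, hs 1, hs 2]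
  ext α
  fin_cases α <;> simp <;> ring

theorem isSolFrame_param (hF : ContDiffOn ℝ ∞ F U) (hN : ContDiffOn ℝ ∞ N U)
    (hunit : ∀ u ∈ U, solInner (F u) (N u) (N u) = 1)
    (hnormal : ∀ u ∈ U, ∀ j, solInner (F u) (fderiv ℝ F u (stdVec j)) (N u) = 0) :
    IsSolFrame (partialDer U) (coordRestr hF) (frameRestr hF hN) where
  torsion k j := funext fun α => smoothRing_ext fun u => by
    have h1 := evalAt_frameCov hF (contDiffOn_fderiv_apply hF j) k α u
    have h2 := evalAt_frameCov hF (contDiffOn_fderiv_apply hF k) j α u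
    rw [paramCov_fderiv_symm hF, ← h2] at h1
    exact h1
  unit := smoothRing_ext fun u => by
    rw [map_one, ← hunit u u.2, solInner_eq_frameVec, map_sum]
    simp only [map_mul]
    rfl
  normal j := smoothRing_ext fun u => by
    rw [map_zero, ← hnormal u u.2 j, solInner_eq_frameVec, map_sum]
    simp only [map_mul]
    rfl

theorem isRestr_frameMetric (hF : ContDiffOn ℝ ∞ F U) (i j : Fin 2) :
    IsRestr (frameMetric (coordRestr hF) i j) fun u => paramMetric F u i j := fun u => by
  change evalAt u (frameMetric (coordRestr hF) i j) = solInner _ _ _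
  rw [solInner_eq_frameVec, frameMetric, map_sum]
  simp only [map_mul]
  rfl

theorem contDiffOn_paramMetric (hF : ContDiffOn ℝ ∞ F U) (i j : Fin 2) :
    ContDiffOn ℝ ∞ (fun u => paramMetric F u i j) U := by
  simp only [paramMetric, Matrix.of_apply, solInner_eq_frameVec]
  exact ContDiffOn.sum fun α _ => (contDiffOn_frameVec hF (contDiffOn_fderiv_apply hF i) α).mul
    (contDiffOn_frameVec hF (contDiffOn_fderiv_apply hF j) α)

theorem solInner_comm (x v w : Coord 3) : solInner x v w = solInner x w v := by
  rw [solInner_eq, solInner_eq]; ring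

theorem paramMetric_symm (F : Coord 2 → Coord 3) (u : Coord 2) (i j : Fin 2) :
    paramMetric F u i j = paramMetric F u j i := solInner_comm _ _ _

theorem isRestr_frameShape (hF : ContDiffOn ℝ ∞ F U) (hN : ContDiffOn ℝ ∞ N U)
    {GR : Fin 2 → Fin 2 → smoothRing U}
    (hG : ∀ i j, IsRestr (GR i j) fun u => (paramMetric F u)⁻¹ i j) (i j : Fin 2) :
    IsRestr (frameShape (partialDer U) GR (coordRestr hF) (frameRestr hF hN) i j)
      (paramShape F N i j) := isRestr_of_evalAt fun u => by
  rw [frameShape, map_sum, paramShape, paramTan]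
  refine Finset.sum_congr rfl fun k _ => ?_
  rw [map_mul, (hG i k).evalAt, frameSecond, map_neg, map_sum, solInner_eq_frameVec,
    ← Finset.sum_neg_distrib]
  refine congrArg _ (Finset.sum_congr rfl fun α _ => ?_)
  rw [map_mul, evalAt_frameCov]
  have : frameVec (F u) (-paramCov F N j u) α = -frameVec (F u) (paramCov F N j u) α := by
    fin_cases α <;> simp [frameVec]
  rw [this, neg_mul]
  rfl

theorem solInner_E₃ (x y w : Coord 3) : solInner x (E₃ y) w = w 2 := by
  rw [solInner_eq]; simp [E₃, stdVec]

/-- Smoothness is free once the components are known to be restrictions of ring elements. -/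
theorem contDiffOn_paramShape (hF : ContDiffOn ℝ ∞ F U) (hN : ContDiffOn ℝ ∞ N U)
    (hdet : ∀ u ∈ U, (paramMetric F u).det ≠ 0) (i j : Fin 2) :
    ContDiffOn ℝ ∞ (paramShape F N i j) U := by
  have hgs := contDiffOn_paramMetric hF
  exact (isRestr_frameShape hF hN
    (GR := fun i j => restr _ (contDiffOn_inv hdet hgs i j)) (fun _ _ _ => rfl) i j).contDiffOn

theorem paramShape_symm (hF : ContDiffOn ℝ ∞ F U) (hN : ContDiffOn ℝ ∞ N U)
    (hunit : ∀ u ∈ U, solInner (F u) (N u) (N u) = 1)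
    (hnormal : ∀ u ∈ U, ∀ j, solInner (F u) (fderiv ℝ F u (stdVec j)) (N u) = 0)
    (hdet : ∀ u ∈ U, (paramMetric F u).det ≠ 0) (u : U) (i j : Fin 2) :
    ∑ l, paramMetric F u i l * paramShape F N l j u
      = ∑ l, paramMetric F u j l * paramShape F N l i u := by
  have hgs := contDiffOn_paramMetric hF
  have hg := isRestr_frameMetric hF
  have hL := isLeviCivita_christoffel (paramMetric_symm F) hdet hg
    (GR := fun i j => restr _ (contDiffOn_inv hdet hgs i j))
    (ΓR := fun k i j => restr _ (contDiffOn_christoffel U.isOpen hdet hgs k i j))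
    (fun _ _ _ => rfl) (fun _ _ _ _ => rfl)
  have hS := isRestr_frameShape hF hN
    (GR := fun i j => restr _ (contDiffOn_inv hdet hgs i j)) (fun _ _ _ => rfl)
  have h := congrArg (evalAt u)
    ((isSolFrame_param hF hN hunit hnormal).frameShape_symm hL i j)
  simpa only [map_sum, map_mul, (hg _ _).evalAt, (hS _ _).evalAt] using h

/-- Simons' formula for a parametrized surface of constant mean curvature in `Sol₃`. -/
theorem simons_param (hF : ContDiffOn ℝ ∞ F U) (hN : ContDiffOn ℝ ∞ N U)
    (hunit : ∀ u ∈ U, solInner (F u) (N u) (N u) = 1)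
    (hnormal : ∀ u ∈ U, ∀ j, solInner (F u) (fderiv ℝ F u (stdVec j)) (N u) = 0)
    (hdet : ∀ u ∈ U, (paramMetric F u).det ≠ 0) {c : ℝ}
    (hcmc : ∀ u ∈ U, ∑ i, paramShape F N i i u = c) (u : U) :
    coordDiv (paramMetric F) (fun l v => ∑ k, (paramMetric F v)⁻¹ l k *
        pderiv k (fun w => ∑ i, ∑ j, paramShape F N i j w * paramShape F N j i w) v) u
      = 2 * coordNormSqCovDeriv (paramMetric F) (paramShape F N) u
        + 8 * coordDiv (paramMetric F) (fun l v => ∑ m, paramShape F N l m v *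
            (N v 2 * paramTan F m v (E₃ (F v)))) u
        - 4 * (c * coordDiv (paramMetric F) (fun l v => N v 2 * paramTan F l v (E₃ (F v))) u)
        + 2 * coordGaussCurvature (paramMetric F) u *
          (2 * (∑ i, ∑ j, paramShape F N i j u * paramShape F N j i u) - c * c)
        - 16 * (N u 2 * N u 2 * (1 - N u 2 * N u 2)) := by
  have hgs := contDiffOn_paramMetric hF
  set GR : Fin 2 → Fin 2 → smoothRing U := fun i j => restr _ (contDiffOn_inv hdet hgs i j)
  set ΓR : Fin 2 → Fin 2 → Fin 2 → smoothRing U := fun k i j =>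
    restr _ (contDiffOn_christoffel U.isOpen hdet hgs k i j)
  have hG : ∀ i j, IsRestr (GR i j) fun u => (paramMetric F u)⁻¹ i j := fun i j => fun _ => rfl
  have hΓ : ∀ k i j, IsRestr (ΓR k i j) (christoffel (paramMetric F) k i j) :=
    fun k i j => fun _ => rfl
  have hg := isRestr_frameMetric hF
  have hL := isLeviCivita_christoffel (paramMetric_symm F) hdet hg hG hΓ
  have hfr := isSolFrame_param hF hN hunit hnormal
  set SR := frameShape (partialDer U) GR (coordRestr hF) (frameRestr hF hN) with hSR
  have hS : ∀ i j, IsRestr (SR i j) (paramShape F N i j) := isRestr_frameShape hF hN hG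
  have htr : ∑ i, SR i i = algebraMap ℝ _ c := smoothRing_ext fun v => by
    rw [map_sum]
    simp only [(hS _ _).evalAt, hcmc v v.2, AlgHom.commutes]
    rfl
  set BR : Fin 2 → smoothRing U := fun i =>
    frameRestr hF hN 2 * ∑ k, GR i k * coordRestr hF k 2 with hBR
  have hB : ∀ l, IsRestr (BR l) fun v => N v 2 * paramTan F l v (E₃ (F v)) := fun l => isRestr_of_evalAt fun v => by
    simp only [hBR, map_mul, map_sum, paramTan, solInner_E₃]
    rfl
  have hdR : ContDiffOn ℝ ∞ (fun v => ((paramMetric F v).det)⁻¹) U := by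
    refine ContDiffOn.inv ?_ hdet
    simp only [Matrix.det_fin_two]
    exact ((hgs 0 0).mul (hgs 1 1)).sub ((hgs 0 1).mul (hgs 1 0))
  -- The determinant is invertible in the ring because it vanishes nowhere on `U`, so the Gaussian
  -- curvature is itself a ring element.
  set κ : smoothRing U := restr _ hdR *
    ∑ l, frameMetric (coordRestr hF) l 0 * ringCurvature (partialDer U) ΓR l 0 1 1 with hκdef
  have hκ : ∑ l, frameMetric (coordRestr hF) l 0 * ringCurvature (partialDer U) ΓR l 0 1 1
      = κ * (frameMetric (coordRestr hF) 0 0 * frameMetric (coordRestr hF) 1 1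
        - frameMetric (coordRestr hF) 0 1 * frameMetric (coordRestr hF) 1 0) :=
    smoothRing_ext fun v => by
      have h1 := hdet v v.2
      rw [hκdef]
      simp only [map_mul, map_sub, (hg _ _).evalAt, evalAt_restr]
      rw [← Matrix.det_fin_two]
      field_simp
  have hκu : evalAt u κ = coordGaussCurvature (paramMetric F) u := by
    rw [hκdef, coordGaussCurvature, map_mul, map_sum, evalAt_restr, mul_comm, div_eq_mul_inv]
    simp only [map_mul, (hg _ _).evalAt, evalAt_ringCurvature hΓ]
  have hu2 : IsRestr (∑ i, ∑ j, SR i j * SR j i)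
      fun w => ∑ i, ∑ j, paramShape F N i j w * paramShape F N j i w := isRestr_of_evalAt fun v => by
    simp only [map_sum, map_mul, (hS _ _).evalAt]
  have hgrad : ∀ l, IsRestr (∑ k, GR l k * partialDer U k (∑ i, ∑ j, SR i j * SR j i))
      fun v => ∑ k, (paramMetric F v)⁻¹ l k *
        pderiv k (fun w => ∑ i, ∑ j, paramShape F N i j w * paramShape F N j i w) v :=
    fun l => isRestr_of_evalAt fun v => by
      rw [map_sum]
      exact Finset.sum_congr rfl fun k _ => by
        rw [map_mul, (hG l k).evalAt, evalAt_partialDer hu2]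
  have hSB : ∀ l, IsRestr (∑ m, SR l m * BR m)
      fun v => ∑ m, paramShape F N l m v * (N v 2 * paramTan F m v (E₃ (F v))) := fun l => isRestr_of_evalAt fun v => by
    simp only [map_sum, map_mul, (hS _ _).evalAt, (hB _).evalAt]
  have main := congrArg (evalAt u) (hfr.simons hL hκ hSR hBR
    (fun k => by rw [htr, Derivation.map_algebraMap]))
  rw [htr] at main
  have hn2 : evalAt u (frameRestr hF hN 2) = N u 2 := rfl
  simp only [map_add, map_sub, map_mul, map_ofNat, map_one, AlgHom.commutes,
    evalAt_ringDiv hΓ hgrad, evalAt_ringDiv hΓ hSB, evalAt_ringDiv hΓ hB, hκu, hu2.evalAt,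
    hn2] at main
  rw [main]
  simp only [map_sum, map_mul, (hg _ _).evalAt, (hG _ _).evalAt, evalAt_covMixed hΓ hS,
    coordNormSqCovDeriv]
  rfl

end Parametrized

/-! ### Reduction to the coordinates of a chart -/

section Chart

open Topology

variable {M : Type*} [TopologicalSpace M] [ChartedSpace (EuclideanSpace ℝ (Fin 2)) M]

/-- The domain of the coordinates at `p`. -/
def chartDomain (p : M) : TopologicalSpace.Opens (Coord 2) :=
  ⟨(extChartAt (𝓡 2) p).target, isOpen_extChartAt_target p⟩

theorem chartCoord_mem (p : M) : chartCoord p p ∈ chartDomain p :=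
  mem_extChartAt_target p

theorem chartPoint_mem {p : M} {u : Coord 2} (hu : u ∈ chartDomain p) :
    chartPoint p u ∈ (extChartAt (𝓡 2) p).source :=
  (extChartAt (𝓡 2) p).map_target hu

theorem chartCoord_chartPoint {p : M} {u : Coord 2} (hu : u ∈ chartDomain p) :
    chartCoord p (chartPoint p u) = u :=
  (extChartAt (𝓡 2) p).right_inv hu

theorem chartPoint_chartCoord (p : M) : chartPoint p (chartCoord p p) = p :=
  extChartAt_to_inv p

/-- Components of a tangent vector, as a linear map. -/
def componentL (p q : M) (i : Fin 2) : TangentSpace (𝓡 2) q →ₗ[ℝ] ℝ :=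
  ((EuclideanSpace.proj (𝕜 := ℝ) i : Coord 2 →L[ℝ] ℝ).comp
    (mfderiv (𝓡 2) (𝓡 2) (chartCoord p) q : Coord 2 →L[ℝ] Coord 2)).toLinearMap

theorem componentL_apply (p q : M) (i : Fin 2) (v : TangentSpace (𝓡 2) q) :
    componentL p q i v = component p q i v := rfl

theorem sum_stdVec (w : Coord 2) : w = ∑ i, w i • stdVec i := by
  ext j
  fin_cases j <;> simp [stdVec]

theorem sum_tangentBasis (q : M) (v : TangentSpace (𝓡 2) q) :
    v = ∑ i, (show Coord 2 from v) i • tangentBasis q i :=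
  sum_stdVec v

/-- The contraction is `tr(g⁻¹ Qᵀ)`, and a change of basis `J` conjugates `g⁻¹ Qᵀ`. -/
theorem sum_inv_mul_congr (J g Q : Matrix (Fin 2) (Fin 2) ℝ) (hJ : IsUnit J.det) :
    ∑ i, ∑ k, (J.transpose * g * J)⁻¹ i k * (J.transpose * Q * J) i k
      = ∑ i, ∑ k, g⁻¹ i k * Q i k := by
  have tr : ∀ X Y : Matrix (Fin 2) (Fin 2) ℝ,
      ∑ i, ∑ k, X i k * Y i k = (X * Y.transpose).trace := fun X Y => by
    simp [Matrix.trace, Matrix.mul_apply]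
  have hJt : IsUnit J.transpose.det := by rwa [Matrix.det_transpose]
  rw [tr, tr, Matrix.mul_inv_rev, Matrix.mul_inv_rev, Matrix.transpose_mul, Matrix.transpose_mul,
    Matrix.transpose_transpose]
  have : J⁻¹ * (g⁻¹ * (J.transpose)⁻¹) * (J.transpose * (Q.transpose * J))
      = J⁻¹ * (g⁻¹ * Q.transpose * J) := by
    simp only [Matrix.mul_assoc]
    rw [Matrix.nonsing_inv_mul_cancel_left _ _ hJt]
  rw [this, Matrix.trace_mul_comm, Matrix.mul_assoc, Matrix.mul_nonsing_inv _ hJ, Matrix.mul_one]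

variable [IsManifold (𝓡 2) ∞ M]

theorem mdifferentiableAt_chartPoint {p : M} {u : Coord 2} (hu : u ∈ chartDomain p) :
    MDifferentiableAt (𝓡 2) (𝓡 2) (chartPoint p) u :=
  ((contMDiffOn_extChartAt_symm (n := ∞) p).contMDiffAt
    ((chartDomain p).isOpen.mem_nhds hu)).mdifferentiableAt (by simp)

theorem mdifferentiableAt_chartCoord {p q : M} (hq : q ∈ (extChartAt (𝓡 2) p).source) :
    MDifferentiableAt (𝓡 2) (𝓡 2) (chartCoord p) q := by
  have : q ∈ (chartAt (EuclideanSpace ℝ (Fin 2)) p).source := by rwa [extChartAt_source] at hq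
  exact (contMDiffAt_extChartAt' (n := ∞) this).mdifferentiableAt (by simp)

theorem mfderiv_chartCoord_chartPoint {p : M} {u : Coord 2} (hu : u ∈ chartDomain p)
    (v : Coord 2) :
    (mfderiv (𝓡 2) (𝓡 2) (chartCoord p) (chartPoint p u)
      (mfderiv (𝓡 2) (𝓡 2) (chartPoint p) u v) : Coord 2) = v := by
  have h := mfderiv_comp_apply (I := 𝓡 2) (I' := 𝓡 2) (I'' := 𝓡 2) u
    (mdifferentiableAt_chartCoord (chartPoint_mem hu)) (mdifferentiableAt_chartPoint hu) v
  have e : chartCoord p ∘ chartPoint p =ᶠ[𝓝 u] id :=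
    Filter.eventuallyEq_of_mem ((chartDomain p).isOpen.mem_nhds hu)
      fun w hw => chartCoord_chartPoint hw
  rw [e.mfderiv_eq, mfderiv_id] at h
  exact h.symm

theorem mfderiv_chartPoint_chartCoord {p : M} {u : Coord 2} (hu : u ∈ chartDomain p)
    (v : TangentSpace (𝓡 2) (chartPoint p u)) :
    mfderiv (𝓡 2) (𝓡 2) (chartPoint p) u
      (mfderiv (𝓡 2) (𝓡 2) (chartCoord p) (chartPoint p u) v : Coord 2) = v := by
  have hq := chartPoint_mem hu
  have h := mfderiv_comp_apply_of_eq (I := 𝓡 2) (I' := 𝓡 2) (I'' := 𝓡 2)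
    (f := chartCoord p) (g := chartPoint p) (x := chartPoint p u) (y := u)
    (mdifferentiableAt_chartPoint hu) (mdifferentiableAt_chartCoord hq)
    (chartCoord_chartPoint hu) v
  have e : chartPoint p ∘ chartCoord p =ᶠ[𝓝 (chartPoint p u)] id :=
    Filter.eventuallyEq_of_mem ((isOpen_extChartAt_source p).mem_nhds hq)
      fun w hw => (extChartAt (𝓡 2) p).left_inv hw
  rw [e.mfderiv_eq, mfderiv_id] at h
  exact h.symm

theorem component_coordField {p : M} {u : Coord 2} (hu : u ∈ chartDomain p) (i j : Fin 2) :
    component p (chartPoint p u) i (coordField p j u) = if i = j then 1 else 0 := by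
  have h := congrArg (fun w : Coord 2 => w i) (mfderiv_chartCoord_chartPoint hu (stdVec j))
  refine h.trans ?_
  simp [stdVec]

theorem sum_component_coordField {p : M} {u : Coord 2} (hu : u ∈ chartDomain p)
    (v : TangentSpace (𝓡 2) (chartPoint p u)) :
    v = ∑ i, component p (chartPoint p u) i v • coordField p i u := by
  let A : Coord 2 →ₗ[ℝ] TangentSpace (𝓡 2) (chartPoint p u) :=
    (mfderiv (𝓡 2) (𝓡 2) (chartPoint p) u : Coord 2 →L[ℝ] Coord 2).toLinearMap
  have h := congrArg A (sum_stdVec (mfderiv (𝓡 2) (𝓡 2) (chartCoord p) (chartPoint p u) v))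
  simp only [map_sum, map_smul] at h
  exact (mfderiv_chartPoint_chartCoord hu v).symm.trans h

/-- The metric contraction of a bilinear form does not depend on the basis. -/
theorem sum_inv_mul_bilin {p : M} {u : Coord 2} (hu : u ∈ chartDomain p)
    (G Q : TangentSpace (𝓡 2) (chartPoint p u) →ₗ[ℝ]
      TangentSpace (𝓡 2) (chartPoint p u) →ₗ[ℝ] ℝ) :
    ∑ i, ∑ k, (Matrix.of fun i j => G (tangentBasis _ i) (tangentBasis _ j))⁻¹ i k *
        Q (tangentBasis _ i) (tangentBasis _ k)
      = ∑ i, ∑ k, (Matrix.of fun i j => G (coordField p i u) (coordField p j u))⁻¹ i k *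
        Q (coordField p i u) (coordField p k u) := by
  -- `tangentBasis` at a point belongs to the preferred chart of that point, whereas derivatives are
  -- taken in the chart at `p`. `J` is the change of basis between the two, with inverse `L`.
  let J : Matrix (Fin 2) (Fin 2) ℝ := Matrix.of fun a i => component p (chartPoint p u) a (tangentBasis (chartPoint p u) i)
  let L : Matrix (Fin 2) (Fin 2) ℝ := Matrix.of fun a i => (show Coord 2 from coordField p i u) a
  have hJL : J * L = 1 := by
    ext a i
    have h := congrArg (componentL p (chartPoint p u) a) (sum_tangentBasis (chartPoint p u) (coordField p i u))
    rw [map_sum, componentL_apply, component_coordField hu] at h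
    rw [Matrix.mul_apply, Matrix.one_apply, h]
    refine Finset.sum_congr rfl fun m _ => ?_
    rw [map_smul, smul_eq_mul, mul_comm]
    rfl
  have hJ : IsUnit J.det := Matrix.isUnit_det_of_right_inverse hJL
  have hQ : ∀ Q : TangentSpace (𝓡 2) (chartPoint p u) →ₗ[ℝ] TangentSpace (𝓡 2) (chartPoint p u) →ₗ[ℝ] ℝ,
      (Matrix.of fun i j => Q (tangentBasis (chartPoint p u) i) (tangentBasis (chartPoint p u) j))
        = J.transpose * (Matrix.of fun i j => Q (coordField p i u) (coordField p j u)) * J := by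
    intro Q
    ext i k
    have hi := sum_component_coordField hu (tangentBasis (chartPoint p u) i)
    have hk := sum_component_coordField hu (tangentBasis (chartPoint p u) k)
    rw [Matrix.of_apply, hi, hk]
    simp only [map_add, map_smul, LinearMap.add_apply, LinearMap.smul_apply, smul_eq_mul,
      Matrix.mul_apply, Matrix.transpose_apply, Matrix.of_apply, J, Fin.sum_univ_two]
    ring
  have h := sum_inv_mul_congr J
    (Matrix.of fun i j => G (coordField p i u) (coordField p j u))
    (Matrix.of fun i j => Q (coordField p i u) (coordField p j u)) hJ
  rw [← hQ, ← hQ] at h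
  simpa only [Matrix.of_apply] using h

end Chart

/-! ### The geometry of the surface in the coordinates of one chart -/

section ChartFormulas

open Topology

variable {M : Type*} [TopologicalSpace M] [ChartedSpace (EuclideanSpace ℝ (Fin 2)) M]

/-- The metric of `Sol₃` at `x` as a bilinear form. -/
def solForm (x : Coord 3) : Coord 3 →ₗ[ℝ] Coord 3 →ₗ[ℝ] ℝ :=
  LinearMap.mk₂ ℝ (solInner x)
    (fun v v' w => by simp only [solInner_eq, PiLp.add_apply]; ring)
    (fun c v w => by simp only [solInner_eq, PiLp.smul_apply, smul_eq_mul]; ring)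
    (fun v w w' => by simp only [solInner_eq, PiLp.add_apply]; ring)
    (fun c v w => by simp only [solInner_eq, PiLp.smul_apply, smul_eq_mul]; ring)

theorem solForm_apply (x v w : Coord 3) : solForm x v w = solInner x v w := rfl

/-- The differential as a linear map. -/
def pushL (W : M → Coord 3) (q : M) : TangentSpace (𝓡 2) q →ₗ[ℝ] Coord 3 :=
  (mfderiv (𝓡 2) (𝓡 3) W q : Coord 2 →L[ℝ] Coord 3).toLinearMap

theorem pushL_apply (W : M → Coord 3) (q : M) (v : TangentSpace (𝓡 2) q) :
    pushL W q v = push W q v := rfl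

/-- The induced metric as a bilinear form. -/
def metricL (φ : M → Coord 3) (q : M) :
    TangentSpace (𝓡 2) q →ₗ[ℝ] TangentSpace (𝓡 2) q →ₗ[ℝ] ℝ :=
  (solForm (φ q)).compl₁₂ (pushL φ q) (pushL φ q)

theorem metricL_apply (φ : M → Coord 3) (q : M) (v w : TangentSpace (𝓡 2) q) :
    metricL φ q v w = inducedMetric φ q v w := rfl

theorem tangentPart_add (φ : M → Coord 3) (q : M) (v w : Coord 3) :
    tangentPart φ q (v + w) = tangentPart φ q v + tangentPart φ q w := by
  simp only [tangentPart, ← solForm_apply, map_add, LinearMap.add_apply, mul_add,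
    Finset.sum_add_distrib, add_smul]

theorem tangentPart_smul (φ : M → Coord 3) (q : M) (c : ℝ) (w : Coord 3) :
    tangentPart φ q (c • w) = c • tangentPart φ q w := by
  simp only [tangentPart, ← solForm_apply, map_smul, LinearMap.smul_apply, smul_eq_mul,
    Finset.smul_sum, smul_smul, Finset.mul_sum, mul_left_comm]

theorem ambientCovDeriv_add (φ ξ : M → Coord 3) (q : M) (v w : TangentSpace (𝓡 2) q) :
    ambientCovDeriv φ ξ q (v + w) = ambientCovDeriv φ ξ q v + ambientCovDeriv φ ξ q w := by
  ext k
  simp only [ambientCovDeriv, ← pushL_apply, map_add, PiLp.add_apply, mul_add, add_mul,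
    Finset.sum_add_distrib]
  ring

theorem ambientCovDeriv_smul (φ ξ : M → Coord 3) (q : M) (c : ℝ) (v : TangentSpace (𝓡 2) q) :
    ambientCovDeriv φ ξ q (c • v) = c • ambientCovDeriv φ ξ q v := by
  ext k
  simp only [ambientCovDeriv, ← pushL_apply, map_smul, PiLp.smul_apply, smul_eq_mul, mul_add,
    Finset.mul_sum]
  congr 1
  exact Finset.sum_congr rfl fun i _ => Finset.sum_congr rfl fun j _ => by ring

/-- The shape operator as a linear map. -/
def shapeL (φ ξ : M → Coord 3) (q : M) : TangentSpace (𝓡 2) q →ₗ[ℝ] TangentSpace (𝓡 2) q where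
  toFun := shapeOp φ ξ q
  map_add' v w := by
    simp only [shapeOp]
    rw [ambientCovDeriv_add, neg_add, tangentPart_add]
  map_smul' c v := by
    simp only [shapeOp]
    rw [ambientCovDeriv_smul, ← smul_neg, tangentPart_smul]
    rfl

theorem shapeL_apply (φ ξ : M → Coord 3) (q : M) (v : TangentSpace (𝓡 2) q) :
    shapeL φ ξ q v = shapeOp φ ξ q v := rfl

variable {φ ξ : M → Coord 3}

/-- As `ξ` is a unit field, `⟨ξ, E₃^⊥⟩ = ⟨E₃, ξ⟩`, and the `dz²` part of the metric reads off the
last component. -/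
theorem angle_eq (hξ : IsUnitNormal φ ξ) (q : M) : angle φ ξ q = ξ q 2 := by
  rw [angle, normalPart, ← solForm_apply, map_smul, solForm_apply, hξ.unit, solInner_E₃,
    smul_eq_mul, mul_one]

theorem sum_inv_mul_metric {g : Matrix (Fin 2) (Fin 2) ℝ} (hsymm : ∀ i j, g i j = g j i)
    (hdet : g.det ≠ 0) (a b : Fin 2) : ∑ i, g⁻¹ a i * g b i = if a = b then 1 else 0 := by
  have h := congrArg (fun X => X a b) (Matrix.nonsing_inv_mul g (isUnit_iff_ne_zero.mpr hdet))
  simp only [Matrix.mul_apply, Matrix.one_apply] at h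
  simpa only [hsymm b] using h

variable [IsManifold (𝓡 2) ∞ M]

theorem contDiffOn_comp_chartPoint {W : M → Coord 3} (hW : ContMDiff (𝓡 2) (𝓡 3) ∞ W) (p : M) :
    ContDiffOn ℝ ∞ (fun u => W (chartPoint p u)) (chartDomain p) :=
  contMDiffOn_iff_contDiffOn.mp (hW.comp_contMDiffOn (contMDiffOn_extChartAt_symm p))

theorem push_mfderiv_chartPoint {W : M → Coord 3} (hW : ContMDiff (𝓡 2) (𝓡 3) ∞ W) {p : M}
    {u : Coord 2} (hu : u ∈ chartDomain p) (i : Fin 2) :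
    push W (chartPoint p u) (coordField p i u)
      = fderiv ℝ (fun u => W (chartPoint p u)) u (stdVec i) := by
  have h := mfderiv_comp_apply (I := 𝓡 2) (I' := 𝓡 2) (I'' := 𝓡 3) u
    (hW.mdifferentiableAt (x := chartPoint p u) (by simp)) (mdifferentiableAt_chartPoint hu)
    (stdVec i : Coord 2)
  rw [mfderiv_eq_fderiv] at h
  exact h.symm

theorem chartMetric_eq (hφ : IsSurface φ) {p : M} {u : Coord 2} (hu : u ∈ chartDomain p) :
    chartMetric φ p u = paramMetric (fun u => φ (chartPoint p u)) u := by
  ext i j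
  simp only [chartMetric, paramMetric, Matrix.of_apply, inducedMetric,
    push_mfderiv_chartPoint hφ.smooth hu]

/-- Contraction with the inverse Gram matrix, in the coordinates at `p`. -/
theorem sum_gram_inv (hφ : IsSurface φ) {p : M} {u : Coord 2} (hu : u ∈ chartDomain p)
    (Q : TangentSpace (𝓡 2) (chartPoint p u) →ₗ[ℝ]
      TangentSpace (𝓡 2) (chartPoint p u) →ₗ[ℝ] ℝ) :
    ∑ i, ∑ k, (gram φ (chartPoint p u))⁻¹ i k * Q (tangentBasis _ i) (tangentBasis _ k)
      = ∑ i, ∑ k, (paramMetric (fun u => φ (chartPoint p u)) u)⁻¹ i k *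
        Q (coordField p i u) (coordField p k u) := by
  rw [← chartMetric_eq hφ hu]
  exact sum_inv_mul_bilin hu (metricL φ _) Q

/-- Components of the vector dual to a linear form. -/
theorem component_sum_gram_inv (hφ : IsSurface φ) {p : M} {u : Coord 2} (hu : u ∈ chartDomain p)
    (η : TangentSpace (𝓡 2) (chartPoint p u) →ₗ[ℝ] ℝ) (i : Fin 2) :
    component p (chartPoint p u) i (∑ a, (∑ b, (gram φ (chartPoint p u))⁻¹ a b *
        η (tangentBasis _ b)) • tangentBasis _ a)
      = ∑ k, (paramMetric (fun u => φ (chartPoint p u)) u)⁻¹ i k * η (coordField p k u) := by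
  -- Basis independence is applied to the product of the `i`-th component form with `η`; in the
  -- coordinate frame the first factor is a Kronecker delta.
  have h := sum_gram_inv hφ hu
    ((LinearMap.mul ℝ ℝ).compl₁₂ (componentL p (chartPoint p u) i) η)
  simp only [LinearMap.compl₁₂_apply, LinearMap.mul_apply'] at h
  rw [← componentL_apply, map_sum]
  simp only [map_smul, smul_eq_mul, Finset.sum_mul]
  refine (Finset.sum_congr rfl fun a _ => Finset.sum_congr rfl fun b _ => ?_).trans (h.trans ?_)
  · ring
  · simp only [componentL_apply, component_coordField hu]
    simp

theorem component_tangentPart (hφ : IsSurface φ) {p : M} {u : Coord 2} (hu : u ∈ chartDomain p)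
    (w : Coord 3) (i : Fin 2) :
    component p (chartPoint p u) i (tangentPart φ (chartPoint p u) w)
      = paramTan (fun u => φ (chartPoint p u)) i u w := by
  have h := component_sum_gram_inv hφ hu
    (solForm (φ (chartPoint p u)) w ∘ₗ pushL φ (chartPoint p u)) i
  simp only [LinearMap.comp_apply, pushL_apply, solForm_apply,
    push_mfderiv_chartPoint hφ.smooth hu] at h
  exact h

theorem ambientCovDeriv_coordField (hφ : IsSurface φ) (hξ : IsUnitNormal φ ξ) {p : M}
    {u : Coord 2} (hu : u ∈ chartDomain p) (j : Fin 2) :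
    ambientCovDeriv φ ξ (chartPoint p u) (coordField p j u)
      = paramCov (fun u => φ (chartPoint p u)) (fun u => ξ (chartPoint p u)) j u := by
  simp only [ambientCovDeriv, paramCov, push_mfderiv_chartPoint hφ.smooth hu,
    push_mfderiv_chartPoint hξ.smooth hu]

theorem component_shapeOp_coordField (hφ : IsSurface φ) (hξ : IsUnitNormal φ ξ) {p : M}
    {u : Coord 2} (hu : u ∈ chartDomain p) (i j : Fin 2) :
    component p (chartPoint p u) i (shapeOp φ ξ (chartPoint p u) (coordField p j u))
      = paramShape (fun u => φ (chartPoint p u)) (fun u => ξ (chartPoint p u)) i j u := by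
  rw [shapeOp, component_tangentPart hφ hu, ambientCovDeriv_coordField hφ hξ hu, paramShape]

theorem shapeOp_coordField (hφ : IsSurface φ) (hξ : IsUnitNormal φ ξ) {p : M}
    {u : Coord 2} (hu : u ∈ chartDomain p) (j : Fin 2) :
    shapeOp φ ξ (chartPoint p u) (coordField p j u)
      = ∑ i, paramShape (fun u => φ (chartPoint p u)) (fun u => ξ (chartPoint p u)) i j u •
        coordField p i u := by
  rw [sum_component_coordField hu (shapeOp φ ξ (chartPoint p u) (coordField p j u))]
  simp only [component_shapeOp_coordField hφ hξ hu]

theorem component_shapeOp (hφ : IsSurface φ) (hξ : IsUnitNormal φ ξ) {p : M}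
    {u : Coord 2} (hu : u ∈ chartDomain p) (v : TangentSpace (𝓡 2) (chartPoint p u))
    (i : Fin 2) :
    component p (chartPoint p u) i (shapeOp φ ξ (chartPoint p u) v)
      = ∑ m, paramShape (fun u => φ (chartPoint p u)) (fun u => ξ (chartPoint p u)) i m u *
        component p (chartPoint p u) m v := by
  have h := congrArg (fun w => componentL p (chartPoint p u) i (shapeL φ ξ (chartPoint p u) w))
    (sum_component_coordField hu v)
  simp only [map_sum, map_smul, smul_eq_mul] at h
  refine h.trans (Finset.sum_congr rfl fun m _ => ?_)
  rw [shapeL_apply, componentL_apply, component_shapeOp_coordField hφ hξ hu, mul_comm]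

/-- A null vector of the Gram matrix gives `w` with `|dφ w|² = 0`; then `dφ w = 0` because the
metric of `Sol₃` is definite, and `w = 0` because `φ` is an immersion. -/
theorem det_paramMetric_ne_zero (hφ : IsSurface φ) {p : M} {u : Coord 2}
    (hu : u ∈ chartDomain p) : (paramMetric (fun u => φ (chartPoint p u)) u).det ≠ 0 := by
  rw [← chartMetric_eq hφ hu]
  intro h0
  obtain ⟨v, hv, hv0⟩ := Matrix.exists_mulVec_eq_zero_iff.mpr h0
  apply hv
  set w : TangentSpace (𝓡 2) (chartPoint p u) := ∑ i, v i • coordField p i u with hw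
  have h1 : ∀ i, metricL φ _ (coordField p i u) w = 0 := by
    intro i
    have := congrFun hv0 i
    simp only [Matrix.mulVec, dotProduct] at this
    rw [hw, map_sum]
    refine (Finset.sum_congr rfl fun j _ => ?_).trans this
    rw [map_smul, smul_eq_mul, mul_comm]
    rfl
  have h2 : metricL φ _ w w = 0 := by
    have : metricL φ _ (∑ i, v i • coordField p i u) w = 0 := by
      simp only [map_sum, map_smul, LinearMap.sum_apply, LinearMap.smul_apply, h1, smul_zero,
        Finset.sum_const_zero]
    rwa [← hw] at this
  have h3 : pushL φ _ w = 0 := by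
    rw [metricL_apply, inducedMetric, solInner_eq_frameVec, Fin.sum_univ_three] at h2
    have e : ∀ α, frameVec (φ (chartPoint p u)) (push φ (chartPoint p u) w) α = 0 := by
      intro α
      fin_cases α <;> simp only [Fin.zero_eta, Fin.mk_one, Fin.reduceFinMk] <;> nlinarith
    have e0 := e 0
    have e1 := e 1
    have e2 := e 2
    simp [frameVec] at e0 e1 e2
    ext k
    fin_cases k
    · exact e0
    · exact e1
    · exact e2
  have h4 : w = 0 := hφ.injective _ (h3.trans (map_zero (pushL φ _)).symm)
  funext i
  have h5 := congrArg (componentL p (chartPoint p u) i) h4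
  rw [hw, map_sum, map_zero] at h5
  simpa [componentL_apply, component_coordField hu] using h5

theorem solInner_paramNormal (hφ : IsSurface φ) (hξ : IsUnitNormal φ ξ) {p : M} {u : Coord 2}
    (hu : u ∈ chartDomain p) (j : Fin 2) :
    solInner (φ (chartPoint p u)) (fderiv ℝ (fun u => φ (chartPoint p u)) u (stdVec j))
      (ξ (chartPoint p u)) = 0 := by
  rw [← push_mfderiv_chartPoint hφ.smooth hu]
  exact hξ.normal _ _

end ChartFormulas

/-! ### Dependence of coordinate expressions on germs only -/

section Congruence

open Topology

variable {n : ℕ} {g g' : Coord n → Matrix (Fin n) (Fin n) ℝ} {u : Coord n}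

theorem christoffel_congr (e : g =ᶠ[𝓝 u] g') (k i j : Fin n) :
    christoffel g k i j =ᶠ[𝓝 u] christoffel g' k i j := by
  filter_upwards [e.eventually_nhds] with v hv
  have h : ∀ l a b, pderiv l (fun x => g x a b) v = pderiv l (fun x => g' x a b) v :=
    fun l a b => pderiv_congr (hv.mono fun x hx => by simp only [hx])
  simp only [christoffel, h, hv.self_of_nhds]

theorem coordDiv_congr (e : g =ᶠ[𝓝 u] g') {V V' : Fin n → Coord n → ℝ}
    (eV : ∀ i, V i =ᶠ[𝓝 u] V' i) : coordDiv g V u = coordDiv g' V' u := by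
  simp only [coordDiv, fun i => pderiv_congr (i := i) (eV i), fun i => (eV i).self_of_nhds,
    fun k i j => (christoffel_congr e k i j).self_of_nhds]

theorem coordNormSqCovDeriv_congr (e : g =ᶠ[𝓝 u] g') {T T' : Fin n → Fin n → Coord n → ℝ}
    (eT : ∀ i j, T i j =ᶠ[𝓝 u] T' i j) :
    coordNormSqCovDeriv g T u = coordNormSqCovDeriv g' T' u := by
  have h : ∀ k i j, coordCovDeriv g T k i j u = coordCovDeriv g' T' k i j u := fun k i j => by
    simp only [coordCovDeriv, pderiv_congr (eT i j), fun i j => (eT i j).self_of_nhds,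
      fun k i j => (christoffel_congr e k i j).self_of_nhds]
  simp only [coordNormSqCovDeriv, h, e.self_of_nhds]

theorem coordGaussCurvature_congr {g g' : Coord 2 → Matrix (Fin 2) (Fin 2) ℝ} {u : Coord 2}
    (e : g =ᶠ[𝓝 u] g') : coordGaussCurvature g u = coordGaussCurvature g' u := by
  simp only [coordGaussCurvature, curvature, e.self_of_nhds,
    fun k i j => (christoffel_congr e k i j).self_of_nhds,
    fun l k i j => pderiv_congr (i := l) (christoffel_congr e k i j)]

theorem coordDiv_const_mul (c : ℝ) (V : Fin n → Coord n → ℝ) :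
    coordDiv g (fun i v => c * V i v) u = c * coordDiv g V u := by
  have h : ∀ i, pderiv i (fun v => c * V i v) u = c * pderiv i (V i) u := fun i => by
    change fderiv ℝ (c • V i) u (stdVec i) = _
    -- Over a field constants leave the derivative even where `V i` is not differentiable, so no
    -- smoothness of `V` is assumed.
    rw [fderiv_const_smul_field]
    rfl
  simp only [coordDiv, h, mul_add, Finset.mul_sum, mul_left_comm]

end Congruence

/-! ### Mean curvature, `|A|²`, gradient and divergence in the chart at `p` -/

section MainResult

open Topology

variable {M : Type*} [TopologicalSpace M] [ChartedSpace (EuclideanSpace ℝ (Fin 2)) M]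

theorem eventually_chartDomain {p : M} {u : Coord 2} (hu : u ∈ chartDomain p) {E : Type*}
    {h k : Coord 2 → E} (e : ∀ v ∈ chartDomain p, h v = k v) : h =ᶠ[𝓝 u] k :=
  Filter.eventuallyEq_of_mem ((chartDomain p).isOpen.mem_nhds hu) e

variable [IsManifold (𝓡 2) ∞ M] {φ ξ : M → Coord 3}

theorem paramShape_symm_of_isSurface (hφ : IsSurface φ) (hξ : IsUnitNormal φ ξ) {p : M}
    {u : Coord 2} (hu : u ∈ chartDomain p) (i j : Fin 2) :
    ∑ l, paramMetric (fun u => φ (chartPoint p u)) u i l *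
        paramShape (fun u => φ (chartPoint p u)) (fun u => ξ (chartPoint p u)) l j u
      = ∑ l, paramMetric (fun u => φ (chartPoint p u)) u j l *
        paramShape (fun u => φ (chartPoint p u)) (fun u => ξ (chartPoint p u)) l i u :=
  paramShape_symm (contDiffOn_comp_chartPoint hφ.smooth p) (contDiffOn_comp_chartPoint hξ.smooth p)
    (fun _ _ => hξ.unit _) (fun _ hv => solInner_paramNormal hφ hξ hv)
    (fun _ hv => det_paramMetric_ne_zero hφ hv) ⟨u, hu⟩ i j

theorem inducedMetric_coordField (hφ : IsSurface φ) {p : M} {u : Coord 2}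
    (hu : u ∈ chartDomain p) (i j : Fin 2) :
    metricL φ (chartPoint p u) (coordField p i u) (coordField p j u)
      = paramMetric (fun u => φ (chartPoint p u)) u i j := by
  rw [← chartMetric_eq hφ hu]; rfl

theorem meanCurvature_eq (hφ : IsSurface φ) (hξ : IsUnitNormal φ ξ) {p : M} {u : Coord 2}
    (hu : u ∈ chartDomain p) : meanCurvature φ ξ (chartPoint p u)
      = (1 / 2) * ∑ i,
        paramShape (fun u => φ (chartPoint p u)) (fun u => ξ (chartPoint p u)) i i u := by
  have h := sum_gram_inv hφ hu ((metricL φ _).compl₁₂ (shapeL φ ξ _) LinearMap.id)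
  simp only [LinearMap.compl₁₂_apply, LinearMap.id_apply, shapeL_apply,
    shapeOp_coordField hφ hξ hu, map_sum, map_smul, LinearMap.sum_apply, LinearMap.smul_apply,
    inducedMetric_coordField hφ hu, smul_eq_mul] at h
  refine (congrArg _ h).trans (congrArg _ ?_)
  have hs := paramMetric_symm (fun u => φ (chartPoint p u)) u
  have e := sum_inv_mul_metric hs (det_paramMetric_ne_zero hφ hu)
  have e00 := e 0 0
  have e01 := e 0 1
  have e10 := e 1 0
  have e11 := e 1 1
  simp only [Fin.sum_univ_two, if_true, zero_ne_one, one_ne_zero, if_false] at e00 e01 e10 e11 ⊢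
  linear_combination
    paramShape (fun u => φ (chartPoint p u)) (fun u => ξ (chartPoint p u)) 0 0 u * e00
    + paramShape (fun u => φ (chartPoint p u)) (fun u => ξ (chartPoint p u)) 1 0 u * e01
    + paramShape (fun u => φ (chartPoint p u)) (fun u => ξ (chartPoint p u)) 0 1 u * e10
    + paramShape (fun u => φ (chartPoint p u)) (fun u => ξ (chartPoint p u)) 1 1 u * e11

/-- The squared norm of a self-adjoint endomorphism is the trace of its square. -/
theorem sum_inv_mul_shape {g : Matrix (Fin 2) (Fin 2) ℝ} {S : Fin 2 → Fin 2 → ℝ}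
    (hsymm : ∀ i j, g i j = g j i) (hdet : g.det ≠ 0)
    (hS : ∀ i j, ∑ l, g i l * S l j = ∑ l, g j l * S l i) :
    ∑ i, ∑ k, g⁻¹ i k * ∑ a, S a k * ∑ b, S b i * g b a = ∑ i, ∑ j, S i j * S j i := by
  have e := sum_inv_mul_metric hsymm hdet
  have e' : ∀ k a, ∑ i, g⁻¹ i k * g i a = if k = a then 1 else 0 := by
    intro k a
    rw [← e k a]
    have h := congrArg (fun M => M k) (Matrix.transpose_nonsing_inv g)
    rw [show g.transpose = g from Matrix.ext fun a b => hsymm b a] at h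
    refine Finset.sum_congr rfl fun i _ => ?_
    rw [hsymm i a, ← congrFun h i, Matrix.transpose_apply]
  have h1 : ∀ k a, ∑ i, g⁻¹ i k * ∑ b, S b i * g b a = S k a := by
    intro k a
    have h2 : ∀ i, ∑ b, S b i * g b a = ∑ l, g i l * S l a := fun i => by
      rw [hS i a]
      exact Finset.sum_congr rfl fun b _ => by rw [hsymm b a, mul_comm]
    have h3 : ∑ i, g⁻¹ i k * ∑ l, g i l * S l a = ∑ l, (∑ i, g⁻¹ i k * g i l) * S l a := by
      simp only [Fin.sum_univ_two]; ring
    simp only [h2, h3, e']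
    simp
  have h4 : ∑ i, ∑ k, g⁻¹ i k * ∑ a, S a k * ∑ b, S b i * g b a
      = ∑ k, ∑ a, (∑ i, g⁻¹ i k * ∑ b, S b i * g b a) * S a k := by
    simp only [Fin.sum_univ_two]; ring
  rw [h4]
  simp only [h1]

/-- `|A|²` is the trace of `A* A`, which equals `tr A²` by self-adjointness; the latter involves no
metric and is what the ring computation differentiates. -/
theorem normSqShape_eq (hφ : IsSurface φ) (hξ : IsUnitNormal φ ξ) {p : M} {u : Coord 2}
    (hu : u ∈ chartDomain p) : normSqShape φ ξ (chartPoint p u)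
      = ∑ i, ∑ j,
        paramShape (fun u => φ (chartPoint p u)) (fun u => ξ (chartPoint p u)) i j u *
        paramShape (fun u => φ (chartPoint p u)) (fun u => ξ (chartPoint p u)) j i u := by
  have h := sum_gram_inv hφ hu ((metricL φ _).compl₁₂ (shapeL φ ξ _) (shapeL φ ξ _))
  simp only [LinearMap.compl₁₂_apply, shapeL_apply,
    shapeOp_coordField hφ hξ hu, map_sum, map_smul, LinearMap.sum_apply, LinearMap.smul_apply,
    inducedMetric_coordField hφ hu, smul_eq_mul] at h
  refine h.trans ?_
  have hs := paramMetric_symm (fun u => φ (chartPoint p u)) u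
  have hS := paramShape_symm_of_isSurface hφ hξ hu
  exact sum_inv_mul_shape hs (det_paramMetric_ne_zero hφ hu) hS

theorem component_grad (hφ : IsSurface φ) {p : M} {u : Coord 2} (hu : u ∈ chartDomain p)
    {h : M → ℝ} {H : Coord 2 → ℝ} (hH : ContDiffOn ℝ ∞ H (chartDomain p))
    (e : ∀ v ∈ chartDomain p, h (chartPoint p v) = H v) (i : Fin 2) :
    component p (chartPoint p u) i (grad φ h (chartPoint p u))
      = ∑ k, (paramMetric (fun u => φ (chartPoint p u)) u)⁻¹ i k * pderiv k H u := by
  have hq := chartPoint_mem hu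
  -- Near the point `h` is `H` composed with the chart, so its differentiability comes from that of
  -- `H` and need not be assumed.
  have hd : MDifferentiableAt (𝓡 2) 𝓘(ℝ, ℝ) h (chartPoint p u) := by
    have e1 : H ∘ chartCoord p =ᶠ[𝓝 (chartPoint p u)] h :=
      Filter.eventuallyEq_of_mem ((isOpen_extChartAt_source p).mem_nhds hq) fun q hq => by
        have h1 := e (chartCoord p q) ((extChartAt (𝓡 2) p).map_source hq)
        rw [show chartPoint p (chartCoord p q) = q from (extChartAt (𝓡 2) p).left_inv hq] at h1
        exact h1.symm
    have e2 : DifferentiableAt ℝ H (chartCoord p (chartPoint p u)) := by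
      rw [chartCoord_chartPoint hu]
      exact differentiableAt_of_mem hH ⟨u, hu⟩
    exact (e2.mdifferentiableAt.comp _ (mdifferentiableAt_chartCoord hq)).congr_of_eventuallyEq
      e1.symm
  have h1 : ∀ k, mfderiv (𝓡 2) 𝓘(ℝ, ℝ) h (chartPoint p u) (coordField p k u)
      = pderiv k H u := by
    intro k
    have h2 := mfderiv_comp_apply (I := 𝓡 2) (I' := 𝓡 2) (I'' := 𝓘(ℝ, ℝ)) u hd
      (mdifferentiableAt_chartPoint hu) (stdVec k : Coord 2)
    have e3 : h ∘ chartPoint p =ᶠ[𝓝 u] H := eventually_chartDomain hu e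
    rw [e3.mfderiv_eq, mfderiv_eq_fderiv] at h2
    exact h2.symm
  have h3 := component_sum_gram_inv hφ hu
    (mfderiv (𝓡 2) 𝓘(ℝ, ℝ) h (chartPoint p u) : Coord 2 →L[ℝ] ℝ).toLinearMap i
  refine h3.trans (Finset.sum_congr rfl fun k _ => ?_)
  rw [← h1 k]
  rfl

/-- The metric and the components are controlled only on the chart domain, which suffices because a
divergence depends on germs. -/
theorem coordDiv_chart (hφ : IsSurface φ) {p : M} {V : ∀ q : M, TangentSpace (𝓡 2) q}
    {W : Fin 2 → Coord 2 → ℝ}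
    (hV : ∀ i, ∀ u ∈ chartDomain p, component p (chartPoint p u) i (V (chartPoint p u)) = W i u) :
    div φ V p = coordDiv (paramMetric fun u => φ (chartPoint p u)) W (chartCoord p p) :=
  coordDiv_congr (eventually_chartDomain (chartCoord_mem p) fun _ hv => chartMetric_eq hφ hv)
    fun i => eventually_chartDomain (chartCoord_mem p) (hV i)

end MainResult

end SolGeometry

end

theorem mainTheorem3 {M : Type*} [TopologicalSpace M]
    [ChartedSpace (EuclideanSpace ℝ (Fin 2)) M] [IsManifold (𝓡 2) ∞ M]
    (φ ξ : M → SolGeometry.Coord 3)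
    (hφ : SolGeometry.IsSurface φ) (hξ : SolGeometry.IsUnitNormal φ ξ)
    (hcmc : SolGeometry.IsCMC φ ξ) (p : M) :
    (1 / 2) * SolGeometry.laplacian φ (SolGeometry.normSqShape φ ξ) p
      = SolGeometry.normSqNablaShape φ ξ p
        + 4 * SolGeometry.div φ
            (fun q => SolGeometry.angle φ ξ q •
              SolGeometry.shapeOp φ ξ q (SolGeometry.E₃Tan φ q)) p
        - 4 * SolGeometry.div φ
            (fun q => (SolGeometry.meanCurvature φ ξ q * SolGeometry.angle φ ξ q) •
              SolGeometry.E₃Tan φ q) p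
        + 2 * SolGeometry.gaussCurvature φ p *
            (SolGeometry.normSqShape φ ξ p - 2 * SolGeometry.meanCurvature φ ξ p ^ 2)
        - 8 * SolGeometry.angle φ ξ p ^ 2 * (1 - SolGeometry.angle φ ξ p ^ 2) := by
  open SolGeometry in
  obtain ⟨c, hc⟩ := hcmc
  have hF := contDiffOn_comp_chartPoint hφ.smooth p
  have hN := contDiffOn_comp_chartPoint hξ.smooth p
  have hdet := fun u (hu : u ∈ chartDomain p) => det_paramMetric_ne_zero hφ hu
  set F : Coord 2 → Coord 3 := fun u => φ (chartPoint p u) with hFdef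
  set N : Coord 2 → Coord 3 := fun u => ξ (chartPoint p u) with hNdef
  have htr : ∀ u ∈ chartDomain p, ∑ i, paramShape F N i i u = 2 * c := fun u hu => by
    have h := meanCurvature_eq hφ hξ hu
    rw [hc] at h
    linarith
  have hu₀ := chartCoord_mem p
  have hmetric : chartMetric φ p =ᶠ[nhds (chartCoord p p)] paramMetric F :=
    eventually_chartDomain hu₀ fun _ hv => chartMetric_eq hφ hv
  have hlap : laplacian φ (normSqShape φ ξ) p = coordDiv (paramMetric F) (fun l v => ∑ k,
      (paramMetric F v)⁻¹ l k * pderiv k (fun w => ∑ i, ∑ j,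
        paramShape F N i j w * paramShape F N j i w) v) (chartCoord p p) :=
    coordDiv_chart hφ fun i u hu => component_grad hφ hu
      (ContDiffOn.sum fun i _ => ContDiffOn.sum fun j _ =>
        (contDiffOn_paramShape hF hN hdet i j).mul (contDiffOn_paramShape hF hN hdet j i))
      (fun v hv => normSqShape_eq hφ hξ hv) i
  have hnabla : normSqNablaShape φ ξ p
      = coordNormSqCovDeriv (paramMetric F) (paramShape F N) (chartCoord p p) :=
    coordNormSqCovDeriv_congr hmetric fun i j => eventually_chartDomain hu₀ fun u hu =>
      component_shapeOp_coordField hφ hξ hu i j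
  have hT : ∀ i, ∀ u ∈ chartDomain p, component p (chartPoint p u) i (E₃Tan φ (chartPoint p u))
      = paramTan F i u (E₃ (F u)) := fun i u hu => component_tangentPart hφ hu _ i
  have hdivA : div φ (fun q => angle φ ξ q • shapeOp φ ξ q (E₃Tan φ q)) p
      = coordDiv (paramMetric F) (fun l v => ∑ m, paramShape F N l m v *
          (N v 2 * paramTan F m v (E₃ (F v)))) (chartCoord p p) := by
    refine coordDiv_chart hφ fun i u hu => ?_
    rw [← componentL_apply, map_smul, componentL_apply, component_shapeOp hφ hξ hu,
      angle_eq hξ, smul_eq_mul, Finset.mul_sum]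
    refine Finset.sum_congr rfl fun m _ => ?_
    rw [hT m u hu]
    ring
  have hdivT : div φ (fun q => (meanCurvature φ ξ q * angle φ ξ q) • E₃Tan φ q) p
      = c * coordDiv (paramMetric F) (fun l v => N v 2 * paramTan F l v (E₃ (F v)))
        (chartCoord p p) := by
    rw [← coordDiv_const_mul]
    refine coordDiv_chart hφ fun i u hu => ?_
    rw [← componentL_apply, map_smul, componentL_apply, hT i u hu, angle_eq hξ, hc, smul_eq_mul,
      mul_assoc]
  have hK : gaussCurvature φ p = coordGaussCurvature (paramMetric F) (chartCoord p p) :=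
    coordGaussCurvature_congr hmetric
  have hA := normSqShape_eq hφ hξ hu₀
  rw [chartPoint_chartCoord] at hA
  have hν : N (chartCoord p p) = ξ p := by rw [hNdef]; simp only [chartPoint_chartCoord]
  have main := simons_param hF hN (fun _ _ => hξ.unit _)
    (fun _ hv => solInner_paramNormal hφ hξ hv) hdet htr ⟨_, hu₀⟩
  simp only [hν] at main
  -- The trace in `main` is `2c`. Half of `4 · 2c` is the coefficient `4c` of the second divergence,
  -- and half of `2K(2|A|² - 4c²)` is `2K(|A|² - 2c²)`.
  rw [hlap, hnabla, hdivA, hdivT, hK, hA, hc, angle_eq hξ, main]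
  ring
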